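/- Let $\mathbb K=\mathbb R$ or $\mathbb C$; all objects are $C^\infty$ (holomorphic if $\mathbb K=\mathbb C$). A linear 3-web $\mathcal L$ on an open set $V\subset\mathbb P^2(\mathbb K)$ consists of three enumerated, pairwise transversal foliations of $V$ whose leaves are open pieces of lines. In affine coordinates $(x,y)$ in which the web lines are not vertical, let $P,Q,R$ be their slopes. The $i$-th line through a point touches the focal curve (envelope) of the $i$-th family at a focal point, which for the first family is $(x-\frac1{P_y},\,y-\frac P{P_y})$ (a point at infinity if $P_y=0$), and similarly for the other two. The three focal points are collinear exactly where $D:=P_y(R-Q)+Q_y(P-R)+R_y(Q-P)$ vanishes; let $V^\circ=\{D\neq0\}$ (it is empty for a regular web, i.e. one formed by three pencils with collinear centers). On $V^\circ$ put $$U_1=\tfrac{D\,(dy-P\,dx)}{(P-R)(P-Q)},\quad U_2=\tfrac{D\,(dy-Q\,dx)}{(Q-P)(Q-R)},\quad U_3=\tfrac{D\,(dy-R\,dx)}{(R-Q)(R-P)},$$ $$a=\tfrac{(P-Q)(P-R)(R-Q)P_{yy}}{D^2},\quad b=\tfrac{(Q-R)(Q-P)(P-R)Q_{yy}}{D^2},\quad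 c=\tfrac{(R-P)(R-Q)(Q-P)R_{yy}}{D^2},$$ and for a function $f$ define $f_i=\partial_if$ by $df=f_2U_1-f_1U_2=f_3U_2-f_2U_3=f_1U_3-f_3U_1$. These objects do not depend on the affine coordinates. The signature set of $\mathcal L$ is $S=\sigma(V^\circ)\subset\mathbb K^9$, where $$\sigma=(a,b,c,\partial_2a,\partial_3b,\partial_1c,\partial_2^2a,\partial_3^2b,\partial_1^2c).$$ A point $p\in V^\circ$ is called non-singular if, near $\sigma(p)$, the set $S$ is an embedded submanifold of $\mathbb K^9$ and the rank of $d\sigma$ at $p$ equals its dimension (which may be $0$, $1$ or $2$). Theorem. Let $\mathcal L,\tilde{\mathcal L}$ be two linear planar 3-webs with signature sets $S,\tilde S$, and let $p,\tilde p$ be non-singular points of $\mathcal L,\tilde{\mathcal L}$, respectively, with $\sigma(p)=\tilde\sigma(\tilde p)=s$. If $S\cap W=\tilde S\cap W$ for some open neighbourhood $W$ of $s$ in $\mathbb K^9$, then the germ of $\mathcal L$ at $p$ and the germ of $\tilde{\mathcal L}$ at $\tilde p$ are projectively equivalent: there is a projective transformation $G$ with $G(p)=\tilde p$ that maps, near $p$,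 the $i$-th foliation of $\mathcal L$ to the $i$-th foliation of $\tilde{\mathcal L}$ for $i=1,2,3$. -/

import Mathlib

open scoped ContDiff LinearAlgebra.Projectivization

noncomputable section

namespace PlanarWeb

/-! ### The projective plane and its affine charts -/

/-- The projective plane over `𝕜`. -/
abbrev Plane (𝕜 : Type*) [RCLike 𝕜] : Type _ := ℙ 𝕜 (Fin 3 → 𝕜)

/-- A projective transformation is represented by an invertible linear map of `𝕜³`. -/
abbrev Trans (𝕜 : Type*) [RCLike 𝕜] : Type _ := (Fin 3 → 𝕜) ≃ₗ[𝕜] (Fin 3 → 𝕜)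

/-- Open subsets of the projective plane (quotient topology of `𝕜³ \ {0}`). -/
def IsOpenSet {𝕜 : Type*} [RCLike 𝕜] (V : Set (Plane 𝕜)) : Prop :=
  IsOpen {v : Fin 3 → 𝕜 | ∃ h : v ≠ 0, Projectivization.mk 𝕜 v h ∈ V}

/-- Homogeneous coordinates of the affine point `(x, y)`. -/
def affineVec {𝕜 : Type*} [RCLike 𝕜] (z : 𝕜 × 𝕜) : Fin 3 → 𝕜 := ![z.1, z.2, 1]

theorem affineVec_ne_zero {𝕜 : Type*} [RCLike 𝕜] (z : 𝕜 × 𝕜) : affineVec z ≠ 0 := by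
  intro h
  have := congrFun h 2
  simp [affineVec] at this

/-- The affine chart `(x, y) ↦ g [x : y : 1]` of the projective plane. -/
def affineChart {𝕜 : Type*} [RCLike 𝕜] (g : Trans 𝕜) (z : 𝕜 × 𝕜) : Plane 𝕜 :=
  g • Projectivization.mk 𝕜 (affineVec z) (affineVec_ne_zero z)

/-- The line of slope `k` through the affine point `(x, y)`, as a plane in `𝕜³`. -/
def slopeLine {𝕜 : Type*} [RCLike 𝕜] (z : 𝕜 × 𝕜) (k : 𝕜) : Submodule 𝕜 (Fin 3 → 𝕜) :=
  Submodule.span 𝕜 {affineVec z, ![1, k, 0]}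

/-- In the affine chart `g`, over the open set `U`, the three line fields `line i` on `V` are
the lines `dy = m i dx`, with smooth slopes `m i` (`P, Q, R` for `i = 0, 1, 2`). -/
structure IsSlopeChart {𝕜 : Type*} [RCLike 𝕜] (V : Set (Plane 𝕜))
    (line : Fin 3 → Plane 𝕜 → Submodule 𝕜 (Fin 3 → 𝕜))
    (g : Trans 𝕜) (U : Set (𝕜 × 𝕜)) (m : Fin 3 → 𝕜 × 𝕜 → 𝕜) : Prop where
  isOpen : IsOpen U
  smooth : ∀ i, ContDiffOn 𝕜 ∞ (m i) U
  mem : ∀ z ∈ U, affineChart g z ∈ V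
  line_eq : ∀ z ∈ U, ∀ i,
    line i (affineChart g z) = (slopeLine z (m i z)).map (g : (Fin 3 → 𝕜) →ₗ[𝕜] (Fin 3 → 𝕜))

/-- A (smooth for `𝕜 = ℝ`, holomorphic for `𝕜 = ℂ`) linear 3-web on an open subset of the
projective plane, with enumerated foliations: through each point `p` pass three distinct lines
`line 0 p`, `line 1 p`, `line 2 p`, depending smoothly on `p`, and the leaf of the `i`-th
foliation through `p` is, near `p`, the line `line i p`. -/
structure LinearWeb (𝕜 : Type*) [RCLike 𝕜] where
  carrier : Set (Plane 𝕜)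
  isOpen : IsOpenSet carrier
  line : Fin 3 → Plane 𝕜 → Submodule 𝕜 (Fin 3 → 𝕜)
  finrank_line : ∀ p ∈ carrier, ∀ i, Module.finrank 𝕜 (line i p) = 2
  mem_line : ∀ p ∈ carrier, ∀ i, p.submodule ≤ line i p
  distinct : ∀ p ∈ carrier, ∀ i j, i ≠ j → line i p ≠ line j p
  leaf : ∀ p ∈ carrier, ∃ N : Set (Plane 𝕜), IsOpenSet N ∧ p ∈ N ∧ N ⊆ carrier ∧
    ∀ q ∈ N, ∀ i, q.submodule ≤ line i p → line i q = line i p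
  smooth : ∀ p ∈ carrier, ∃ (g : Trans 𝕜) (U : Set (𝕜 × 𝕜)) (m : Fin 3 → 𝕜 × 𝕜 → 𝕜),
    IsSlopeChart carrier line g U m ∧ ∃ z ∈ U, affineChart g z = p

/-! ### Differential invariants in an affine chart

Throughout, `m 0, m 1, m 2` are the slopes `P, Q, R`, and indices are taken modulo 3. -/

section Invariants

variable {𝕜 : Type*} [RCLike 𝕜]

/-- Partial derivative in `y`. -/
def dY (f : 𝕜 × 𝕜 → 𝕜) (z : 𝕜 × 𝕜) : 𝕜 := fderiv 𝕜 f z (0, 1)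

/-- Homogeneous coordinates of the point where the `i`-th line through `z` touches the focal
curve of the `i`-th foliation, i.e. of `(x - 1 / P_y, y - P / P_y)` (at infinity if `P_y = 0`). -/
def focalVec (m : Fin 3 → 𝕜 × 𝕜 → 𝕜) (i : Fin 3) (z : 𝕜 × 𝕜) : Fin 3 → 𝕜 :=
  dY (m i) z • affineVec z - ![1, m i z, 0]

/-- The three focal points at `z` are not collinear. -/
def NonRegularAt (m : Fin 3 → 𝕜 × 𝕜 → 𝕜) (z : 𝕜 × 𝕜) : Prop :=
  LinearIndependent 𝕜 (fun i => focalVec m i z)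

/-- `P_y (R - Q) + Q_y (P - R) + R_y (Q - P)`. -/
def den (m : Fin 3 → 𝕜 × 𝕜 → 𝕜) (z : 𝕜 × 𝕜) : 𝕜 :=
  ∑ i, dY (m i) z * (m (i + 2) z - m (i + 1) z)

theorem nonRegularAt_iff (m : Fin 3 → 𝕜 × 𝕜 → 𝕜) (z : 𝕜 × 𝕜) :
    NonRegularAt m z ↔ den m z ≠ 0 := by
  have h : (Matrix.of fun i => focalVec m i z).det = den m z := by
    simp [Matrix.det_fin_three, focalVec, affineVec, den, Fin.sum_univ_three]
    ring
  rw [← h, ← isUnit_iff_ne_zero, ← Matrix.isUnit_iff_isUnit_det,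
    ← Matrix.linearIndependent_rows_iff_isUnit]
  rfl

/-- The invariant 1-forms `U₁, U₂, U₃` (for `i = 0, 1, 2`):
`U₁ = [P_y (R - Q) + Q_y (P - R) + R_y (Q - P)] (dy - P dx) / ((P - R) (P - Q))`, etc. -/
def form (m : Fin 3 → 𝕜 × 𝕜 → 𝕜) (i : Fin 3) (z : 𝕜 × 𝕜) : 𝕜 × 𝕜 →L[𝕜] 𝕜 :=
  (den m z / ((m i z - m (i + 2) z) * (m i z - m (i + 1) z))) •
    (ContinuousLinearMap.snd 𝕜 𝕜 𝕜 - m i z • ContinuousLinearMap.fst 𝕜 𝕜 𝕜)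

/-- The invariants `a, b, c` (for `i = 0, 1, 2`):
`a = (P - Q) (P - R) (R - Q) P_yy / [P_y (R - Q) + Q_y (P - R) + R_y (Q - P)] ^ 2`, etc. -/
def inv (m : Fin 3 → 𝕜 × 𝕜 → 𝕜) (i : Fin 3) (z : 𝕜 × 𝕜) : 𝕜 :=
  (m i z - m (i + 1) z) * (m i z - m (i + 2) z) * (m (i + 2) z - m (i + 1) z) *
    dY (dY (m i)) z / den m z ^ 2

/-- The operators `∂₁, ∂₂, ∂₃` (for `i = 0, 1, 2`) determined by
`df = ∂₂f U₁ - ∂₁f U₂ = ∂₃f U₂ - ∂₂f U₃ = ∂₁f U₃ - ∂₃f U₁` (see `fderiv_eq`). -/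
def del (m : Fin 3 → 𝕜 × 𝕜 → 𝕜) (i : Fin 3) (f : 𝕜 × 𝕜 → 𝕜) (z : 𝕜 × 𝕜) : 𝕜 :=
  fderiv 𝕜 f z (((m (i + 1) z - m (i + 2) z) / den m z) • ((1 : 𝕜), m i z))

theorem fderiv_eq (m : Fin 3 → 𝕜 × 𝕜 → 𝕜) (z : 𝕜 × 𝕜) (hz : NonRegularAt m z)
    (hm : ∀ i j, i ≠ j → m i z ≠ m j z) (f : 𝕜 × 𝕜 → 𝕜) (i : Fin 3) :
    fderiv 𝕜 f z = del m (i + 1) f z • form m i z - del m i f z • form m (i + 1) z := by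
  have hd := (nonRegularAt_iff m z).1 hz
  have h01 := sub_ne_zero.2 (hm i (i + 1) (by fin_cases i <;> decide))
  have h02 := sub_ne_zero.2 (hm i (i + 2) (by fin_cases i <;> decide))
  have h12 := sub_ne_zero.2 (hm (i + 1) (i + 2) (by fin_cases i <;> decide))
  have h10 := sub_ne_zero.2 (hm (i + 1) i (by fin_cases i <;> decide))
  have e1 : i + 1 + 1 = i + 2 := by fin_cases i <;> rfl
  have e2 : i + 1 + 2 = i := by fin_cases i <;> rfl
  have key : ∀ s t : 𝕜, fderiv 𝕜 f z (s, t) =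
      s * fderiv 𝕜 f z (1, 0) + t * fderiv 𝕜 f z (0, 1) := by
    intro s t
    have : ((s, t) : 𝕜 × 𝕜) = s • ((1 : 𝕜), (0 : 𝕜)) + t • ((0 : 𝕜), (1 : 𝕜)) := by simp
    rw [this, map_add, map_smul, map_smul, smul_eq_mul, smul_eq_mul]
  ext
  · simp only [ContinuousLinearMap.comp_apply, ContinuousLinearMap.inl_apply,
      sub_apply, smul_apply, del, form, map_smul,
      key 1 (m i z), key 1 (m (i + 1) z), e1, e2, smul_eq_mul, ContinuousLinearMap.coe_fst',
      ContinuousLinearMap.coe_snd']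
    field_simp
    ring
  · simp only [ContinuousLinearMap.comp_apply, ContinuousLinearMap.inr_apply,
      sub_apply, smul_apply, del, form, map_smul,
      key 1 (m i z), key 1 (m (i + 1) z), e1, e2, smul_eq_mul, ContinuousLinearMap.coe_fst',
      ContinuousLinearMap.coe_snd']
    field_simp
    ring

/-- The map `σ = (a, b, c, a₂, b₃, c₁, a₂₂, b₃₃, c₁₁)`. -/
def signature (m : Fin 3 → 𝕜 × 𝕜 → 𝕜) (z : 𝕜 × 𝕜) : Fin 9 → 𝕜 :=
  ![inv m 0 z, inv m 1 z, inv m 2 z,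
    del m 1 (inv m 0) z, del m 2 (inv m 1) z, del m 0 (inv m 2) z,
    del m 1 (del m 1 (inv m 0)) z, del m 2 (del m 2 (inv m 1)) z, del m 0 (del m 0 (inv m 2)) z]

end Invariants

/-! ### Signature sets and germs -/

/-- `S` is, near its point `s`, an embedded smooth submanifold of dimension `d` of `E`
(a regular level set of codimension `k`, where `d + k = dim E`). -/
def IsSubmanifoldAt (𝕜 : Type*) [RCLike 𝕜] {E : Type*} [NormedAddCommGroup E] [NormedSpace 𝕜 E]
    (S : Set E) (s : E) (d : ℕ) : Prop :=
  s ∈ S ∧ ∃ k : ℕ, d + k = Module.finrank 𝕜 E ∧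
    ∃ (W : Set E) (f : E → Fin k → 𝕜), IsOpen W ∧ s ∈ W ∧ ContDiffOn 𝕜 ∞ f W ∧
      Function.Surjective (fderiv 𝕜 f s) ∧ S ∩ W = {x ∈ W | f x = 0}

namespace LinearWeb

variable {𝕜 : Type*} [RCLike 𝕜]

/-- The signature set: the image under `σ` of the set of all points of the web at which the focal
points are not collinear. As `σ` is projectively invariant, each point may be computed in any
affine chart in which none of its three web lines is vertical. -/
def signatureSet (L : LinearWeb 𝕜) : Set (Fin 9 → 𝕜) :=
  {s | ∃ (g : Trans 𝕜) (U : Set (𝕜 × 𝕜)) (m : Fin 3 → 𝕜 × 𝕜 → 𝕜) (z : 𝕜 × 𝕜),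
    IsSlopeChart L.carrier L.line g U m ∧ z ∈ U ∧ NonRegularAt m z ∧ signature m z = s}

/-- `p` is a point of the web with non-collinear focal points, `σ(p) = s`, and `p` is
non-singular: near `s` the signature set is an embedded submanifold, and `σ` parametrizes it
regularly at `p`, i.e. the rank of `dσ` at `p` is the dimension of the submanifold. -/
def IsNonsingularAt (L : LinearWeb 𝕜) (p : Plane 𝕜) (s : Fin 9 → 𝕜) : Prop :=
  ∃ (g : Trans 𝕜) (U : Set (𝕜 × 𝕜)) (m : Fin 3 → 𝕜 × 𝕜 → 𝕜) (z : 𝕜 × 𝕜),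
    IsSlopeChart L.carrier L.line g U m ∧ z ∈ U ∧ affineChart g z = p ∧
    NonRegularAt m z ∧ signature m z = s ∧
    IsSubmanifoldAt 𝕜 L.signatureSet s
      (Module.finrank 𝕜 (fderiv 𝕜 (signature m) z : 𝕜 × 𝕜 →ₗ[𝕜] (Fin 9 → 𝕜)).range)

/-- The germ of `L` at `p` is mapped to the germ of `L'` at `p'` by a projective transformation
(preserving the enumeration of the foliations). -/
def GermProjEquiv (L : LinearWeb 𝕜) (p : Plane 𝕜) (L' : LinearWeb 𝕜) (p' : Plane 𝕜) : Prop :=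
  ∃ G : Trans 𝕜, G • p = p' ∧ ∃ N : Set (Plane 𝕜), IsOpenSet N ∧ p ∈ N ∧
    ∀ q ∈ N, q ∈ L.carrier ∧ G • q ∈ L'.carrier ∧
      ∀ i, L'.line i (G • q) = (L.line i q).map (G : (Fin 3 → 𝕜) →ₗ[𝕜] (Fin 3 → 𝕜))

end LinearWeb

end PlanarWeb

end

/-!
The slopes `P, Q, R`, their derivatives `P_y, Q_y, R_y` and the signature together satisfy a total
differential equation `dw = Φ(w)`, and the theorem is the uniqueness of its solutions.

Since the slopes are constant along the leaves, `P_x = -P P_y`, so the first derivatives of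
`P, Q, R, P_y, Q_y, R_y` are rational in these functions and `P_yy, Q_yy, R_yy`, and the latter are
rational in these functions and `a, b, c`. It remains to see that the derivatives of the signature
along the invariant frame are functions of the signature, the same for both webs. For the components
of order at most one this is algebra: `∂₁ a = a (1 + 2 (b - c))` (`LinearSlopes.del_inv_self`),
`∂₁ + ∂₂ + ∂₃ = 0` and `[∂₁, ∂₂] = (b - c) ∂₂ + (a - c) ∂₁` (`LinearSlopes.lieBracket_frame`),
with their cyclic images, express these derivatives polynomially through the signature. For
`a₂₂, b₃₃, c₁₁` the signature set enters. At two points with the same signature, the derivatives of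
the signatures along the corresponding frame vectors are both tangent to the signature set, and agree
in the first six components. They are equal if the differentials of the first six components have the
same common kernel as the differential of the whole signature. Points where this holds are dense
(`LinearSlopes.exists_mem_ker_le`): on an open set without such points the first six differentials
would have rank at most one, which by a commutator argument would propagate to all further derivatives.
Composing with a smooth local section of the signature map over the signature set
(`exists_local_section`, from the inverse function theorem) writes the derivatives of both signatures
as the same smooth function of the signature
(`LinearSlopes.eventually_fderiv_signature_frame_eq`).

The initial values are matched by a projective transformation. A point and its three focal points
form a projective frame, and this frame determines the 1-jet of the slopes; so there is a
projective transformation that takes `p` to `p'` and, after the corresponding change of the affine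
chart, makes the 1-jets of the slopes at `p` agree (`LinearSlopes.exists_trans_focalVec`,
`LinearSlopes.pullSlope_jet`). The signature and the invariant frame are compatible with this change
of chart (`LinearSlopes.signature_pullSlope`, `LinearSlopes.fderiv_signature_pullSlope`), so by
uniqueness the slopes agree near `p` (`LinearSlopes.eventually_eq_of_jet_eq`). No diffeomorphism
between the webs has to be constructed; the rank of the signature map enters only through the
tangent spaces of the signature set and the existence of the section.
-/

noncomputable section

namespace PlanarWeb

open Filter Topology

variable {𝕜 : Type*} [RCLike 𝕜]

/-! ### Slopes of linear webs -/

theorem _root_.ContDiffAt.dY {f : 𝕜 × 𝕜 → 𝕜} {z : 𝕜 × 𝕜} (hf : ContDiffAt 𝕜 ∞ f z) :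
    ContDiffAt 𝕜 ∞ (dY f) z :=
  (hf.fderiv_right (m := ∞) (by simp)).clm_apply contDiffAt_const

/-- Slopes of three pairwise transversal foliations by lines over an open subset of the affine
plane: the slope is constant along each leaf. -/
structure LinearSlopes (m : Fin 3 → 𝕜 × 𝕜 → 𝕜) (U : Set (𝕜 × 𝕜)) : Prop where
  isOpen : IsOpen U
  smooth : ∀ i, ContDiffOn 𝕜 ∞ (m i) U
  ne : ∀ z ∈ U, ∀ i j, i ≠ j → m i z ≠ m j z
  leaf : ∀ z ∈ U, ∀ i, fderiv 𝕜 (m i) z (1, m i z) = 0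

namespace LinearSlopes

variable {m : Fin 3 → 𝕜 × 𝕜 → 𝕜} {U : Set (𝕜 × 𝕜)} {z : 𝕜 × 𝕜}

theorem contDiffAt (hm : LinearSlopes m U) (hz : z ∈ U) (i : Fin 3) :
    ContDiffAt 𝕜 ∞ (m i) z :=
  (hm.smooth i).contDiffAt (hm.isOpen.mem_nhds hz)

theorem differentiableAt (hm : LinearSlopes m U) (hz : z ∈ U) (i : Fin 3) :
    DifferentiableAt 𝕜 (m i) z :=
  (hm.contDiffAt hz i).differentiableAt (by simp)

theorem differentiableAt_dY (hm : LinearSlopes m U) (hz : z ∈ U) (i : Fin 3) :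
    DifferentiableAt 𝕜 (dY (m i)) z :=
  (hm.contDiffAt hz i).dY.differentiableAt (by simp)

theorem differentiableAt_dY_dY (hm : LinearSlopes m U) (hz : z ∈ U) (i : Fin 3) :
    DifferentiableAt 𝕜 (dY (dY (m i))) z :=
  (hm.contDiffAt hz i).dY.dY.differentiableAt (by simp)

theorem fderiv_eq_along (f : 𝕜 × 𝕜 → 𝕜) (z v : 𝕜 × 𝕜) (k : 𝕜) :
    fderiv 𝕜 f z v = v.1 * fderiv 𝕜 f z (1, k) + (v.2 - v.1 * k) * dY f z := by
  have : v = v.1 • ((1 : 𝕜), k) + (v.2 - v.1 * k) • ((0 : 𝕜), (1 : 𝕜)) := by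
    ext <;> simp
  conv_lhs => rw [this]
  rw [map_add, map_smul, map_smul]
  simp [dY]

theorem fderiv_slope (hm : LinearSlopes m U) (hz : z ∈ U) (i : Fin 3) (v : 𝕜 × 𝕜) :
    fderiv 𝕜 (m i) z v = (v.2 - v.1 * m i z) * dY (m i) z := by
  rw [fderiv_eq_along _ _ _ (m i z), hm.leaf z hz i]
  simp

theorem fderiv_dir (hm : LinearSlopes m U) (hz : z ∈ U) (i : Fin 3) (v : 𝕜 × 𝕜) :
    fderiv 𝕜 (fun w => ((1 : 𝕜), m i w)) z v = (0, (v.2 - v.1 * m i z) * dY (m i) z) := by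
  have h := (hasFDerivAt_const (1 : 𝕜) z).prodMk (hm.differentiableAt hz i).hasFDerivAt
  rw [h.fderiv]
  simp [hm.fderiv_slope hz]

theorem differentiableAt_dir (hm : LinearSlopes m U) (hz : z ∈ U) (i : Fin 3) :
    DifferentiableAt 𝕜 (fun w => ((1 : 𝕜), m i w)) z :=
  (differentiableAt_const _).prodMk (hm.differentiableAt hz i)

/-- Commuting the derivative along the leaves with the derivative in `y`. -/
theorem fderiv_dY_dir (hm : LinearSlopes m U) (hz : z ∈ U) (i : Fin 3) {f : 𝕜 × 𝕜 → 𝕜}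
    (hf : ContDiffAt 𝕜 ∞ f z) :
    fderiv 𝕜 (dY f) z (1, m i z) =
      dY (fun w => fderiv 𝕜 f w (1, m i w)) z - dY (m i) z * dY f z := by
  have h := VectorField.fderiv_apply_lieBracket (V := fun _ => ((0 : 𝕜), (1 : 𝕜)))
    (W := fun w => ((1 : 𝕜), m i w)) hf
    (by rw [minSmoothness_of_isRCLikeNormedField]; exact ENat.LEInfty.out)
    (hm.differentiableAt_dir hz i) (differentiableAt_const _)
  rw [VectorField.lieBracket, hm.fderiv_dir hz] at h
  have h2 := fderiv_eq_along f z (0, dY (m i) z) 0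
  simp at h h2
  rw [h2] at h
  change _ = dY (fun w => fderiv 𝕜 f w (1, m i w)) z - fderiv 𝕜 (dY f) z (1, m i z) at h
  change dY (m i) z * _ = _ at h
  linear_combination h

theorem fderiv_dY (hm : LinearSlopes m U) (hz : z ∈ U) (i : Fin 3) (v : 𝕜 × 𝕜) :
    fderiv 𝕜 (dY (m i)) z v =
      (v.2 - v.1 * m i z) * dY (dY (m i)) z - v.1 * dY (m i) z ^ 2 := by
  have h0 : (fun w => fderiv 𝕜 (m i) w (1, m i w)) =ᶠ[𝓝 z] fun _ => 0 := by
    filter_upwards [hm.isOpen.mem_nhds hz] with w hw using hm.leaf w hw i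
  rw [fderiv_eq_along _ _ _ (m i z), hm.fderiv_dY_dir hz i (hm.contDiffAt hz i)]
  rw [show dY (fun w => fderiv 𝕜 (m i) w (1, m i w)) z = 0 by simp [dY, h0.fderiv_eq]]
  ring

theorem fderiv_dY_dY (hm : LinearSlopes m U) (hz : z ∈ U) (i : Fin 3) :
    fderiv 𝕜 (dY (dY (m i))) z (1, m i z) = -3 * dY (m i) z * dY (dY (m i)) z := by
  have h0 : (fun w => fderiv 𝕜 (dY (m i)) w (1, m i w)) =ᶠ[𝓝 z] fun w => - dY (m i) w ^ 2 := by
    filter_upwards [hm.isOpen.mem_nhds hz] with w hw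
    simp [hm.fderiv_dY hw]
  rw [hm.fderiv_dY_dir hz i (hm.contDiffAt hz i).dY]
  have : dY (fun w => fderiv 𝕜 (dY (m i)) w (1, m i w)) z =
      - (2 * dY (m i) z * dY (dY (m i)) z) := by
    have h1 : HasFDerivAt (fun w => - dY (m i) w ^ 2) _ z :=
      ((hm.differentiableAt_dY hz i).hasFDerivAt.pow 2).neg
    rw [dY, h0.fderiv_eq, h1.fderiv]
    simp [dY]
  rw [this]
  ring

end LinearSlopes

/-! ### Invariants, the invariant frame and its commutation relations -/

theorem add_one_add_one (i : Fin 3) : i + 1 + 1 = i + 2 := by fin_cases i <;> rfl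
theorem add_one_add_two (i : Fin 3) : i + 1 + 2 = i := by fin_cases i <;> rfl
theorem add_two_add_one (i : Fin 3) : i + 2 + 1 = i := by fin_cases i <;> rfl
theorem add_two_add_two (i : Fin 3) : i + 2 + 2 = i + 1 := by fin_cases i <;> rfl

theorem sum_cyclic {M : Type*} [AddCommMonoid M] (F : Fin 3 → M) (i : Fin 3) :
    ∑ j, F j = F i + F (i + 1) + F (i + 2) := by
  rw [Fin.sum_univ_three]
  fin_cases i
  · rfl
  · change _ = F 1 + F 2 + F 0; abel
  · change _ = F 2 + F 0 + F 1; abel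

theorem hasDerivAt_line {f : 𝕜 × 𝕜 → 𝕜} {z : 𝕜 × 𝕜} (hf : DifferentiableAt 𝕜 f z)
    (v : 𝕜 × 𝕜) {c : 𝕜} (h : fderiv 𝕜 f z v = c) :
    HasDerivAt (fun t : 𝕜 => f (z + t • v)) c 0 :=
  h ▸ hf.hasFDerivAt.hasLineDerivAt v

theorem fderiv_eq_of_line {f : 𝕜 × 𝕜 → 𝕜} {z : 𝕜 × 𝕜} (hf : DifferentiableAt 𝕜 f z)
    {v : 𝕜 × 𝕜} {c : 𝕜} (h : HasDerivAt (fun t : 𝕜 => f (z + t • v)) c 0) :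
    fderiv 𝕜 f z v = c :=
  (hasDerivAt_line hf v rfl).unique h

theorem den_eq (m : Fin 3 → 𝕜 × 𝕜 → 𝕜) (i : Fin 3) :
    den m = fun z => dY (m i) z * (m (i + 2) z - m (i + 1) z) +
      dY (m (i + 1)) z * (m i z - m (i + 2) z) +
      dY (m (i + 2)) z * (m (i + 1) z - m i z) := by
  funext z
  rw [den, sum_cyclic _ i]
  simp only [add_one_add_one, add_one_add_two, add_two_add_one, add_two_add_two]

/-- The factor by which all three invariants `inv m i` differ from the second derivatives of the
slopes. -/
def weight (m : Fin 3 → 𝕜 × 𝕜 → 𝕜) (z : 𝕜 × 𝕜) : 𝕜 :=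
  (m 0 z - m 1 z) * (m 0 z - m 2 z) * (m 2 z - m 1 z) / den m z ^ 2

theorem weight_eq (m : Fin 3 → 𝕜 × 𝕜 → 𝕜) (i : Fin 3) :
    weight m = fun z => (m i z - m (i + 1) z) * (m i z - m (i + 2) z) *
      (m (i + 2) z - m (i + 1) z) / den m z ^ 2 := by
  funext z
  rw [weight]
  congr 1
  fin_cases i
  · rfl
  · change _ = (m 1 z - m 2 z) * (m 1 z - m 0 z) * (m 0 z - m 2 z); ring
  · change _ = (m 2 z - m 0 z) * (m 2 z - m 1 z) * (m 1 z - m 0 z); ring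

theorem inv_eq_weight_mul (m : Fin 3 → 𝕜 × 𝕜 → 𝕜) (i : Fin 3) :
    inv m i = fun z => weight m z * dY (dY (m i)) z := by
  funext z
  rw [weight_eq m i, inv]
  ring

/-- The vector fields of the derivations `del m i`. -/
def frame (m : Fin 3 → 𝕜 × 𝕜 → 𝕜) (i : Fin 3) (z : 𝕜 × 𝕜) : 𝕜 × 𝕜 :=
  ((m (i + 1) z - m (i + 2) z) / den m z) • ((1 : 𝕜), m i z)

theorem del_eq (m : Fin 3 → 𝕜 × 𝕜 → 𝕜) (i : Fin 3) (f : 𝕜 × 𝕜 → 𝕜) :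
    del m i f = fun z => fderiv 𝕜 f z (frame m i z) := rfl

theorem frame_sum (m : Fin 3 → 𝕜 × 𝕜 → 𝕜) (i : Fin 3) (z : 𝕜 × 𝕜) :
    frame m (i + 2) z = - frame m i z - frame m (i + 1) z := by
  simp only [frame, add_one_add_one, add_one_add_two, add_two_add_one, add_two_add_two]
  ext <;> simp <;> ring

theorem del_sum (m : Fin 3 → 𝕜 × 𝕜 → 𝕜) (i : Fin 3) (f : 𝕜 × 𝕜 → 𝕜) (z : 𝕜 × 𝕜) :
    del m (i + 2) f z = - del m i f z - del m (i + 1) f z := by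
  simp only [del_eq, frame_sum, map_sub, map_neg]

namespace LinearSlopes

variable {m : Fin 3 → 𝕜 × 𝕜 → 𝕜} {U : Set (𝕜 × 𝕜)} {z : 𝕜 × 𝕜}

theorem contDiffAt_den (hm : LinearSlopes m U) (hz : z ∈ U) : ContDiffAt 𝕜 ∞ (den m) z := by
  rw [den_eq m 0]
  have := fun i => hm.contDiffAt hz i
  have := fun i => (hm.contDiffAt hz i).dY
  fun_prop

theorem contDiffAt_weight (hm : LinearSlopes m U) (hz : z ∈ U) (hd : den m z ≠ 0) :
    ContDiffAt 𝕜 ∞ (weight m) z := by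
  have := fun i => hm.contDiffAt hz i
  refine ContDiffAt.div ?_ ((hm.contDiffAt_den hz).pow 2) (pow_ne_zero 2 hd)
  fun_prop

theorem contDiffAt_inv (hm : LinearSlopes m U) (hz : z ∈ U) (hd : den m z ≠ 0) (i : Fin 3) :
    ContDiffAt 𝕜 ∞ (inv m i) z := by
  rw [inv_eq_weight_mul]
  exact (hm.contDiffAt_weight hz hd).mul (hm.contDiffAt hz i).dY.dY

theorem contDiffAt_frame (hm : LinearSlopes m U) (hz : z ∈ U) (hd : den m z ≠ 0) (i : Fin 3) :
    ContDiffAt 𝕜 ∞ (frame m i) z :=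
  (((hm.contDiffAt hz _).sub (hm.contDiffAt hz _)).div (hm.contDiffAt_den hz) hd).smul
    (contDiffAt_const.prodMk (hm.contDiffAt hz i))

theorem contDiffAt_del (hm : LinearSlopes m U) (hz : z ∈ U) (hd : den m z ≠ 0) (i : Fin 3)
    {f : 𝕜 × 𝕜 → 𝕜} (hf : ContDiffAt 𝕜 ∞ f z) : ContDiffAt 𝕜 ∞ (del m i f) z :=
  (hf.fderiv_right (m := ∞) (by simp)).clm_apply (hm.contDiffAt_frame hz hd i)

theorem contDiffAt_signature (hm : LinearSlopes m U) (hz : z ∈ U) (hd : den m z ≠ 0) :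
    ContDiffAt 𝕜 ∞ (signature m) z := by
  have h0 := fun i => hm.contDiffAt_inv hz hd i
  have h1 := fun i j => hm.contDiffAt_del hz hd i (h0 j)
  have h2 := fun i j k => hm.contDiffAt_del hz hd i (h1 j k)
  rw [contDiffAt_pi]
  intro j
  fin_cases j
  exacts [h0 0, h0 1, h0 2, h1 1 0, h1 2 1, h1 0 2, h2 1 1 0, h2 2 2 1, h2 0 0 2]

theorem fderiv_den (hm : LinearSlopes m U) (hz : z ∈ U) (i : Fin 3) :
    fderiv 𝕜 (den m) z (1, m i z) =
      -(dY (m i) z + dY (m (i + 1)) z + dY (m (i + 2)) z) * den m z +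
      (m i z - m (i + 1) z) * (m i z - m (i + 2) z) *
        (dY (dY (m (i + 1))) z - dY (dY (m (i + 2))) z) := by
  have h0 := fun j => hasDerivAt_line (hm.differentiableAt hz j) _
    (hm.fderiv_slope hz j (1, m i z))
  have h1 := fun j => hasDerivAt_line (hm.differentiableAt_dY hz j) _
    (hm.fderiv_dY hz j (1, m i z))
  apply fderiv_eq_of_line ((hm.contDiffAt_den hz).differentiableAt (by simp))
  rw [den_eq m i]
  refine HasDerivAt.congr_deriv ((((h1 i).mul ((h0 (i + 2)).sub (h0 (i + 1)))).add
    ((h1 (i + 1)).mul ((h0 i).sub (h0 (i + 2))))).add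
    ((h1 (i + 2)).mul ((h0 (i + 1)).sub (h0 i)))) ?_
  simp only [zero_smul, add_zero, Pi.sub_apply]
  ring

/-- `∂₁ a = a (1 + 2 (b - c))` and its cyclic images. -/
theorem del_inv_self (hm : LinearSlopes m U) (hz : z ∈ U) (hd : den m z ≠ 0) (i : Fin 3) :
    del m i (inv m i) z =
      inv m i z * (1 + 2 * (inv m (i + 1) z - inv m (i + 2) z)) := by
  have h0 := fun j => hasDerivAt_line (hm.differentiableAt hz j) _
    (hm.fderiv_slope hz j (1, m i z))
  have h2 := hasDerivAt_line (hm.differentiableAt_dY_dY hz i) _ (hm.fderiv_dY_dY hz i)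
  have hD := hasDerivAt_line ((hm.contDiffAt_den hz).differentiableAt (by simp)) _
    (hm.fderiv_den hz i)
  have h := fderiv_eq_of_line ((hm.contDiffAt_inv hz hd i).differentiableAt (by simp)) <|
    (((((h0 i).sub (h0 (i + 1))).mul ((h0 i).sub (h0 (i + 2)))).mul
      ((h0 (i + 2)).sub (h0 (i + 1)))).mul h2).div (hD.pow 2) (by simpa using hd)
  simp only [del_eq, frame, map_smul]
  rw [h]
  simp only [inv_eq_weight_mul, weight_eq m i]
  have e := congrFun (den_eq m i) z
  simp only [zero_smul, add_zero, Pi.mul_apply, Pi.sub_apply, one_mul, sub_self, zero_mul,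
    smul_eq_mul, Nat.cast_ofNat, Nat.add_one_sub_one, pow_one]
  clear h h0 h2 hD
  generalize den m z = D at *
  generalize m i z = P, m (i + 1) z = Q, m (i + 2) z = R at *
  generalize dY (dY (m i)) z = P2, dY (dY (m (i + 1))) z = Q2, dY (dY (m (i + 2))) z = R2 at *
  generalize dY (m i) z = P1, dY (m (i + 1)) z = Q1, dY (m (i + 2)) z = R1 at *
  field_simp
  linear_combination -(D * P2 * (P - Q) * (P - R) * (R - Q)) * e

theorem fderiv_frame (hm : LinearSlopes m U) (hz : z ∈ U) (hd : den m z ≠ 0) (j : Fin 3)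
    (v : 𝕜 × 𝕜) :
    fderiv 𝕜 (frame m j) z v =
      ((((v.2 - v.1 * m (j + 1) z) * dY (m (j + 1)) z -
          (v.2 - v.1 * m (j + 2) z) * dY (m (j + 2)) z) * den m z -
        (m (j + 1) z - m (j + 2) z) * fderiv 𝕜 (den m) z v) / den m z ^ 2) • ((1 : 𝕜), m j z) +
      ((m (j + 1) z - m (j + 2) z) / den m z) •
        ((0 : 𝕜), (v.2 - v.1 * m j z) * dY (m j) z) := by
  have hD := (hm.contDiffAt_den hz).differentiableAt (by simp)
  have hq : DifferentiableAt 𝕜 (fun w => (m (j + 1) w - m (j + 2) w) / den m w) z :=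
    (((hm.contDiffAt hz _).sub (hm.contDiffAt hz _)).div (hm.contDiffAt_den hz)
      hd).differentiableAt (by simp)
  have e := hq.hasFDerivAt.smul (hm.differentiableAt_dir hz j).hasFDerivAt
  have e' : HasFDerivAt (frame m j) _ z := e
  rw [e'.fderiv]
  simp only [add_apply, smul_apply,
    ContinuousLinearMap.smulRight_apply]
  rw [hm.fderiv_dir hz, add_comm]
  congr 2
  apply fderiv_eq_of_line hq
  refine HasDerivAt.congr_deriv (((hasDerivAt_line (hm.differentiableAt hz (j + 1)) v
    (hm.fderiv_slope hz _ _)).sub (hasDerivAt_line (hm.differentiableAt hz (j + 2)) v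
    (hm.fderiv_slope hz _ _))).div (hasDerivAt_line hD v rfl) (by simpa using hd)) ?_
  simp only [zero_smul, add_zero, Pi.sub_apply]

/-- The commutator `[∂₁, ∂₂]` of the invariant vector fields and its cyclic images. -/
theorem lieBracket_frame (hm : LinearSlopes m U) (hz : z ∈ U) (hd : den m z ≠ 0) (i : Fin 3) :
    VectorField.lieBracket 𝕜 (frame m i) (frame m (i + 1)) z =
      (inv m (i + 1) z - inv m (i + 2) z) • frame m (i + 1) z +
      (inv m i z - inv m (i + 2) z) • frame m i z := by
  rw [VectorField.lieBracket, hm.fderiv_frame hz hd, hm.fderiv_frame hz hd]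
  simp only [frame, map_smul, hm.fderiv_den hz]
  simp only [inv_eq_weight_mul, weight_eq m i, add_one_add_one, add_one_add_two,
    Prod.smul_mk, smul_eq_mul, Prod.mk_add_mk, Prod.mk_sub_mk, mul_zero, add_zero, mul_one]
  generalize den m z = D at *
  generalize m i z = P, m (i + 1) z = Q, m (i + 2) z = R at *
  generalize dY (dY (m i)) z = P2, dY (dY (m (i + 1))) z = Q2, dY (dY (m (i + 2))) z = R2 at *
  generalize dY (m i) z = P1, dY (m (i + 1)) z = Q1, dY (m (i + 2)) z = R1 at *
  ext
  · simp only
    field_simp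
    ring
  · simp only
    field_simp
    ring

theorem del_del_comm (hm : LinearSlopes m U) (hz : z ∈ U) (hd : den m z ≠ 0) (i : Fin 3)
    {f : 𝕜 × 𝕜 → 𝕜} (hf : ContDiffAt 𝕜 ∞ f z) :
    del m i (del m (i + 1) f) z = del m (i + 1) (del m i f) z +
      (inv m (i + 1) z - inv m (i + 2) z) * del m (i + 1) f z +
      (inv m i z - inv m (i + 2) z) * del m i f z := by
  have h := VectorField.fderiv_apply_lieBracket hf
    (by rw [minSmoothness_of_isRCLikeNormedField]; exact ENat.LEInfty.out)
    ((hm.contDiffAt_frame hz hd (i + 1)).differentiableAt (by simp))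
    ((hm.contDiffAt_frame hz hd i).differentiableAt (by simp))
  rw [hm.lieBracket_frame hz hd, map_add, map_smul, map_smul] at h
  simp only [del_eq]
  simp only [smul_eq_mul] at h
  linear_combination -h

end LinearSlopes

/-! ### Independence of the invariants of order at most one -/

theorem eq_or_eq_add_one_or_eq_add_two (i j : Fin 3) : i = j ∨ i = j + 1 ∨ i = j + 2 := by
  fin_cases i <;> fin_cases j <;> decide

namespace LinearSlopes

variable {m : Fin 3 → 𝕜 × 𝕜 → 𝕜} {U : Set (𝕜 × 𝕜)} {z : 𝕜 × 𝕜}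

theorem isOpen_den_ne (hm : LinearSlopes m U) : IsOpen {z | z ∈ U ∧ den m z ≠ 0} := by
  have : ContinuousOn (den m) U := fun w hw => (hm.contDiffAt_den hw).continuousAt.continuousWithinAt
  exact this.isOpen_inter_preimage hm.isOpen isOpen_compl_singleton

theorem eventually_den_ne (hm : LinearSlopes m U) (hz : z ∈ U) (hd : den m z ≠ 0) :
    ∀ᶠ w in 𝓝 z, w ∈ U ∧ den m w ≠ 0 :=
  hm.isOpen_den_ne.mem_nhds ⟨hz, hd⟩

theorem differentiableAt_inv (hm : LinearSlopes m U) (hz : z ∈ U) (hd : den m z ≠ 0)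
    (i : Fin 3) : DifferentiableAt 𝕜 (inv m i) z :=
  (hm.contDiffAt_inv hz hd i).differentiableAt (by simp)

theorem fderiv_del_inv_self (hm : LinearSlopes m U) (hz : z ∈ U) (hd : den m z ≠ 0)
    (i : Fin 3) (v : 𝕜 × 𝕜) :
    fderiv 𝕜 (del m i (inv m i)) z v =
      fderiv 𝕜 (inv m i) z v * (1 + 2 * (inv m (i + 1) z - inv m (i + 2) z)) +
      inv m i z * (2 * (fderiv 𝕜 (inv m (i + 1)) z v - fderiv 𝕜 (inv m (i + 2)) z v)) := by
  have h0 : del m i (inv m i) =ᶠ[𝓝 z]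
      fun w => inv m i w * (1 + 2 * (inv m (i + 1) w - inv m (i + 2) w)) := by
    filter_upwards [hm.eventually_den_ne hz hd] with w hw
    exact hm.del_inv_self hw.1 hw.2 i
  have d := fun j => (hm.differentiableAt_inv hz hd j).hasFDerivAt
  have h1 : HasFDerivAt (fun w => inv m i w * (1 + 2 * (inv m (i + 1) w - inv m (i + 2) w))) _ z :=
    (d i).mul ((((d (i + 1)).sub (d (i + 2))).const_mul 2).const_add 1)
  rw [h0.fderiv_eq, h1.fderiv]
  simp
  ring

/-- The derivative `∂₁∂₂ a`, expressed through the invariants and their first derivatives. -/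
theorem del_del_inv (hm : LinearSlopes m U) (hz : z ∈ U) (hd : den m z ≠ 0) (i : Fin 3) :
    del m i (del m (i + 1) (inv m i)) z =
      del m (i + 1) (inv m i) z * (1 + 2 * (inv m (i + 1) z - inv m (i + 2) z)) +
      inv m i z * (2 * (del m (i + 1) (inv m (i + 1)) z - del m (i + 1) (inv m (i + 2)) z)) +
      (inv m (i + 1) z - inv m (i + 2) z) * del m (i + 1) (inv m i) z +
      (inv m i z - inv m (i + 2) z) * del m i (inv m i) z := by
  rw [hm.del_del_comm hz hd i (hm.contDiffAt_inv hz hd i)]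
  have := hm.fderiv_del_inv_self hz hd i (frame m (i + 1) z)
  change del m (i + 1) (del m i (inv m i)) z = del m (i + 1) (inv m i) z * _ +
    inv m i z * (2 * (del m (i + 1) (inv m (i + 1)) z - del m (i + 1) (inv m (i + 2)) z)) at this
  rw [this]

/-- All first derivatives of the invariants are determined by `a, b, c, a₂, b₃, c₁`. -/
theorem del_inv_congr {m' : Fin 3 → 𝕜 × 𝕜 → 𝕜} {U' : Set (𝕜 × 𝕜)} {z' : 𝕜 × 𝕜}
    (hm : LinearSlopes m U) (hz : z ∈ U) (hd : den m z ≠ 0)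
    (hm' : LinearSlopes m' U') (hz' : z' ∈ U') (hd' : den m' z' ≠ 0)
    (h0 : ∀ j, inv m j z = inv m' j z')
    (h1 : ∀ j, del m (j + 1) (inv m j) z = del m' (j + 1) (inv m' j) z') (i j : Fin 3) :
    del m i (inv m j) z = del m' i (inv m' j) z' := by
  have hs : ∀ j, del m j (inv m j) z = del m' j (inv m' j) z' := fun j => by
    rw [hm.del_inv_self hz hd, hm'.del_inv_self hz' hd', h0, h0, h0]
  rcases eq_or_eq_add_one_or_eq_add_two i j with rfl | rfl | rfl
  · exact hs _
  · exact h1 _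
  · rw [del_sum, del_sum, hs, h1]

/-- All first derivatives of `a₂, b₃, c₁` are determined by the signature. -/
theorem del_del_inv_congr {m' : Fin 3 → 𝕜 × 𝕜 → 𝕜} {U' : Set (𝕜 × 𝕜)} {z' : 𝕜 × 𝕜}
    (hm : LinearSlopes m U) (hz : z ∈ U) (hd : den m z ≠ 0)
    (hm' : LinearSlopes m' U') (hz' : z' ∈ U') (hd' : den m' z' ≠ 0)
    (h0 : ∀ j, inv m j z = inv m' j z')
    (h1 : ∀ j, del m (j + 1) (inv m j) z = del m' (j + 1) (inv m' j) z')
    (h2 : ∀ j, del m (j + 1) (del m (j + 1) (inv m j)) z =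
      del m' (j + 1) (del m' (j + 1) (inv m' j)) z') (i j : Fin 3) :
    del m i (del m (j + 1) (inv m j)) z = del m' i (del m' (j + 1) (inv m' j)) z' := by
  have h := hm.del_inv_congr hz hd hm' hz' hd' h0 h1
  have hs : ∀ j, del m j (del m (j + 1) (inv m j)) z =
      del m' j (del m' (j + 1) (inv m' j)) z' := fun j => by
    rw [hm.del_del_inv hz hd, hm'.del_del_inv hz' hd']
    simp only [h0, h]
  rcases eq_or_eq_add_one_or_eq_add_two i j with rfl | rfl | rfl
  · exact hs _
  · exact h2 _
  · rw [del_sum, del_sum, hs, h2]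

/-- A vector that kills the differentials of `a, b, c, a₂, b₃, c₁` kills those of all first
derivatives of `a, b, c`. -/
theorem fderiv_del_inv_eq_zero (hm : LinearSlopes m U) (hz : z ∈ U) (hd : den m z ≠ 0)
    {u : 𝕜 × 𝕜} (h0 : ∀ j, fderiv 𝕜 (inv m j) z u = 0)
    (h1 : ∀ j, fderiv 𝕜 (del m (j + 1) (inv m j)) z u = 0) (i j : Fin 3) :
    fderiv 𝕜 (del m i (inv m j)) z u = 0 := by
  have hs : ∀ j, fderiv 𝕜 (del m j (inv m j)) z u = 0 := fun j => by
    simp [hm.fderiv_del_inv_self hz hd, h0]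
  rcases eq_or_eq_add_one_or_eq_add_two i j with rfl | rfl | rfl
  · exact hs _
  · exact h1 _
  · have d := fun k => ((hm.contDiffAt_del hz hd k
      (hm.contDiffAt_inv hz hd j)).differentiableAt (by simp)).hasFDerivAt
    have e : del m (j + 2) (inv m j) =
      fun w => - del m j (inv m j) w - del m (j + 1) (inv m j) w := funext (del_sum m j _)
    have h : HasFDerivAt (fun w => - del m j (inv m j) w - del m (j + 1) (inv m j) w) _ z :=
      (d j).neg.sub (d (j + 1))
    rw [e, h.fderiv]
    simp [hs, h1]

end LinearSlopes

theorem exists_eq_smul_of_map_eq_zero {l : 𝕜 × 𝕜 →L[𝕜] 𝕜} (hl : l ≠ 0) {u : 𝕜 × 𝕜}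
    (hu : l u = 0) : ∃ c : 𝕜, u = c • (l (0, 1), - l (1, 0)) := by
  have key : ∀ v : 𝕜 × 𝕜, l v = v.1 * l (1, 0) + v.2 * l (0, 1) := by
    intro v
    have : v = v.1 • ((1 : 𝕜), (0 : 𝕜)) + v.2 • ((0 : 𝕜), (1 : 𝕜)) := by simp
    conv_lhs => rw [this, map_add, map_smul, map_smul]
    rfl
  rw [key] at hu
  by_cases h : l (1, 0) = 0
  · have h' : l (0, 1) ≠ 0 := by
      intro h'
      apply hl
      ext <;> simp [h, h']
    refine ⟨u.1 / l (0, 1), ?_⟩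
    have : u.2 = 0 := by simpa [h, h'] using hu
    ext <;> simp [h, h', this]
  · refine ⟨- u.2 / l (1, 0), ?_⟩
    ext
    · simp
      field_simp
      linear_combination hu
    · simp
      field_simp

/-- If a vector field `Z` in the kernel of `df` kills `g` and the derivative of `f` along `X`, and
`df` determines `dg` up to a factor, then `Z` kills the derivative of `g` along `X` as well. -/
theorem fderiv_fderiv_eq_zero {f g : 𝕜 × 𝕜 → 𝕜} {X Z : 𝕜 × 𝕜 → 𝕜 × 𝕜} {q : 𝕜 × 𝕜}
    (hf : ContDiffAt 𝕜 ∞ f q) (hg : ContDiffAt 𝕜 ∞ g q)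
    (hX : DifferentiableAt 𝕜 X q) (hZ : DifferentiableAt 𝕜 Z q)
    (hZf : ∀ᶠ w in 𝓝 q, fderiv 𝕜 f w (Z w) = 0) (hZg : ∀ᶠ w in 𝓝 q, fderiv 𝕜 g w (Z w) = 0)
    (hXf : fderiv 𝕜 (fun w => fderiv 𝕜 f w (X w)) q (Z q) = 0)
    (hfg : ∀ u, fderiv 𝕜 f q u = 0 → fderiv 𝕜 g q u = 0) :
    fderiv 𝕜 (fun w => fderiv 𝕜 g w (X w)) q (Z q) = 0 := by
  have h2 : minSmoothness 𝕜 2 ≤ (∞ : WithTop ℕ∞) := by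
    rw [minSmoothness_of_isRCLikeNormedField]; exact ENat.LEInfty.out
  have e1 := VectorField.fderiv_apply_lieBracket hf h2 hX hZ
  have e2 := VectorField.fderiv_apply_lieBracket hg h2 hX hZ
  have z1 : fderiv 𝕜 (fun w => fderiv 𝕜 f w (Z w)) q = 0 := by
    rw [EventuallyEq.fderiv_eq (f := fun _ => (0 : 𝕜)) hZf]; simp
  have z2 : fderiv 𝕜 (fun w => fderiv 𝕜 g w (Z w)) q = 0 := by
    rw [EventuallyEq.fderiv_eq (f := fun _ => (0 : 𝕜)) hZg]; simp
  rw [z1, hXf] at e1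
  rw [z2, hfg _ (by simpa using e1)] at e2
  simpa using e2.symm

namespace LinearSlopes

variable {m : Fin 3 → 𝕜 × 𝕜 → 𝕜} {U : Set (𝕜 × 𝕜)}

/-- Points at which the differentials of `a, b, c, a₂, b₃, c₁` have the same common kernel as
the differential of the signature are dense. Otherwise, on some open set, the former would have
rank at most one, hence so would the differentials of all derivatives of `a, b, c`. -/
theorem exists_mem_ker_le (hm : LinearSlopes m U) {O : Set (𝕜 × 𝕜)} (hO : IsOpen O)
    (hne : O.Nonempty) (hOU : ∀ q ∈ O, q ∈ U ∧ den m q ≠ 0) :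
    ∃ q ∈ O, ∀ u, (∀ j, fderiv 𝕜 (inv m j) q u = 0) →
      (∀ j, fderiv 𝕜 (del m (j + 1) (inv m j)) q u = 0) →
      ∀ j, fderiv 𝕜 (del m (j + 1) (del m (j + 1) (inv m j))) q u = 0 := by
  by_contra! hcon
  have c0 := fun q hq j => hm.contDiffAt_inv (hOU q hq).1 (hOU q hq).2 j
  have c1 := fun q hq i j => hm.contDiffAt_del (hOU q hq).1 (hOU q hq).2 i (c0 q hq j)
  -- if `a, b, c` are locally constant, so is the signature; otherwise one of them serves as a
  -- coordinate of which all other components are functions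
  by_cases hall : ∀ q ∈ O, ∀ j, fderiv 𝕜 (inv m j) q = 0
  · obtain ⟨q, hq⟩ := hne
    obtain ⟨u, -, -, j, hj⟩ := hcon q hq
    have e1 : ∀ w ∈ O, del m (j + 1) (inv m j) w = 0 := fun w hw => by
      simp [del, hall w hw]
    have ev : ∀ {f : 𝕜 × 𝕜 → 𝕜}, (∀ w ∈ O, f w = 0) → ∀ w ∈ O, fderiv 𝕜 f w = 0 := by
      intro f hf w hw
      have : f =ᶠ[𝓝 w] fun _ => (0 : 𝕜) := by
        filter_upwards [hO.mem_nhds hw] with t ht using hf t ht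
      rw [this.fderiv_eq]; simp
    have e2 : ∀ w ∈ O, del m (j + 1) (del m (j + 1) (inv m j)) w = 0 := fun w hw => by
      rw [del, ev e1 w hw]; simp
    exact hj (by rw [ev e2 q hq]; simp)
  · push Not at hall
    obtain ⟨q, hq, k, hk⟩ := hall
    set f := inv m k with hf
    have hfq : ContDiffAt 𝕜 ∞ (fderiv 𝕜 f) q := (c0 q hq k).fderiv_right (by simp)
    have hev : ∀ᶠ w in 𝓝 q, w ∈ O ∧ fderiv 𝕜 f w ≠ 0 :=
      (hO.eventually_mem hq).and (hfq.continuousAt.eventually_ne hk)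
    -- `Z` spans the kernel of `df`, hence the common kernel in the six components
    let Z : 𝕜 × 𝕜 → 𝕜 × 𝕜 := fun w => (fderiv 𝕜 f w (0, 1), - fderiv 𝕜 f w (1, 0))
    have hZd : DifferentiableAt 𝕜 Z q := by
      have := hfq.differentiableAt (by simp)
      exact (this.clm_apply (differentiableAt_const _)).prodMk
        (this.clm_apply (differentiableAt_const _)).neg
    have hZ : ∀ w ∈ O, fderiv 𝕜 f w ≠ 0 →
        (∀ j, fderiv 𝕜 (inv m j) w (Z w) = 0) ∧
        (∀ j, fderiv 𝕜 (del m (j + 1) (inv m j)) w (Z w) = 0) := by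
      intro w hw hfw
      obtain ⟨u, hu0, hu1, j, hj⟩ := hcon w hw
      obtain ⟨c, hc⟩ := exists_eq_smul_of_map_eq_zero hfw (hu0 k)
      have hc0 : c ≠ 0 := by
        rintro rfl
        rw [hc, zero_smul, map_zero] at hj
        exact hj rfl
      refine ⟨fun i => ?_, fun i => ?_⟩
      · have := hu0 i
        rw [hc, map_smul, smul_eq_mul] at this
        exact (mul_eq_zero.1 this).resolve_left hc0
      · have := hu1 i
        rw [hc, map_smul, smul_eq_mul] at this
        exact (mul_eq_zero.1 this).resolve_left hc0
    obtain ⟨u, hu0, -, j, hj⟩ := hcon q hq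
    obtain ⟨c, hc⟩ := exists_eq_smul_of_map_eq_zero hk (hu0 k)
    have key : fderiv 𝕜 (del m (j + 1) (del m (j + 1) (inv m j))) q (Z q) = 0 := by
      refine fderiv_fderiv_eq_zero (c0 q hq k) (c1 q hq (j + 1) j)
        ((hm.contDiffAt_frame (hOU q hq).1 (hOU q hq).2 (j + 1)).differentiableAt (by simp)) hZd
        (hev.mono fun w hw => (hZ w hw.1 hw.2).1 k) (hev.mono fun w hw => (hZ w hw.1 hw.2).2 j)
        (hm.fderiv_del_inv_eq_zero (hOU q hq).1 (hOU q hq).2 (hZ q hq hk).1 (hZ q hq hk).2 _ _) ?_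
      intro v hv
      obtain ⟨d, hd⟩ := exists_eq_smul_of_map_eq_zero hk hv
      rw [hd, map_smul, (hZ q hq hk).2 j, smul_zero]
    exact hj (by rw [hc, map_smul, key, smul_zero])

end LinearSlopes

/-! ### Level sets and local sections -/

section LocalSection

variable {E F : Type*} [NormedAddCommGroup E] [NormedSpace 𝕜 E] [NormedAddCommGroup F]
  [NormedSpace 𝕜 F]

theorem exists_reflexive_generalized_inverse [FiniteDimensional 𝕜 E] [FiniteDimensional 𝕜 F]
    (L : E →L[𝕜] F) :
    ∃ A : F →L[𝕜] E, (∀ u, L (A (L u)) = L u) ∧ ∀ x, A (L (A x)) = A x := by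
  obtain ⟨r, hr⟩ := (L : E →ₗ[𝕜] F).rangeRestrict.exists_rightInverse_of_surjective
    (LinearMap.range_rangeRestrict _)
  obtain ⟨p, hp⟩ := ((L : E →ₗ[𝕜] F).range.subtype).exists_leftInverse_of_injective
    (Submodule.ker_subtype _)
  have h : ∀ u, L (r (p (L u))) = L u := by
    intro u
    have h1 : p (L u) = (L : E →ₗ[𝕜] F).rangeRestrict u :=
      LinearMap.congr_fun hp ((L : E →ₗ[𝕜] F).rangeRestrict u)
    rw [h1]
    exact congrArg Subtype.val (LinearMap.congr_fun hr ((L : E →ₗ[𝕜] F).rangeRestrict u))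
  let A₀ : F →L[𝕜] E := (r ∘ₗ p).toContinuousLinearMap
  have hA₀ : ∀ u, L (A₀ (L u)) = L u := h
  refine ⟨A₀.comp (L.comp A₀), fun u => ?_, fun x => ?_⟩
  · simp [hA₀]
  · simp [hA₀]

theorem eventually_isUnit {X : Type*} [TopologicalSpace X] [CompleteSpace E] {C : X → E →L[𝕜] E}
    {x : X} (hC : ContinuousAt C x) (h1 : C x = 1) :
    ∀ᶠ y in 𝓝 x, Function.Bijective (C y) := by
  have : ∀ᶠ T in 𝓝 (C x), IsUnit T := by
    rw [h1]
    exact Units.isOpen.mem_nhds isUnit_one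
  filter_upwards [hC.eventually this] with y hy
  exact ContinuousLinearMap.isUnit_iff_bijective.1 hy

variable {k : ℕ} {σ : E → F} {z : E}
  {f : F → Fin k → 𝕜}

theorem fderiv_comp_eq_zero {s : F} (hσ : DifferentiableAt 𝕜 σ z) (hz : σ z = s)
    (hf : DifferentiableAt 𝕜 f s) (h0 : ∀ᶠ w in 𝓝 z, f (σ w) = 0) (u : E) :
    fderiv 𝕜 f s (fderiv 𝕜 σ z u) = 0 := by
  subst hz
  have h := fderiv_comp z hf hσ
  have h' : (f ∘ σ) =ᶠ[𝓝 z] fun _ => 0 := h0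
  rw [h'.fderiv_eq] at h
  simpa using (DFunLike.congr_fun h u).symm

theorem ker_eq_range [FiniteDimensional 𝕜 F] {L : E →L[𝕜] F} {M : F →L[𝕜] (Fin k → 𝕜)} (hM : Function.Surjective M)
    (hr : Module.finrank 𝕜 (L : E →ₗ[𝕜] F).range + k = Module.finrank 𝕜 F)
    (h0 : ∀ u, M (L u) = 0) : (L : E →ₗ[𝕜] F).range = (M : F →ₗ[𝕜] (Fin k → 𝕜)).ker := by
  apply Submodule.eq_of_le_of_finrank_eq
  · rintro _ ⟨u, rfl⟩
    exact h0 u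
  · have h1 := (M : F →ₗ[𝕜] (Fin k → 𝕜)).finrank_range_add_finrank_ker
    have h2 : (M : F →ₗ[𝕜] (Fin k → 𝕜)).range = ⊤ := LinearMap.range_eq_top.2 hM
    rw [h2, finrank_top, Module.finrank_fin_fun] at h1
    omega

variable [FiniteDimensional 𝕜 E] [FiniteDimensional 𝕜 F]

/-- The tangent spaces of a level set of `f` into which `σ` maps, with full rank at `z`, are the
images of the differentials of `σ` at the points near `z`. -/
theorem eventually_ker_le_range (hσ : ContDiffAt 𝕜 ∞ σ z) (hf : ContDiffAt 𝕜 ∞ f (σ z))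
    (hsurj : Function.Surjective (fderiv 𝕜 f (σ z)))
    (hr : Module.finrank 𝕜 (fderiv 𝕜 σ z : E →ₗ[𝕜] F).range + k = Module.finrank 𝕜 F)
    (h0 : ∀ᶠ w in 𝓝 z, f (σ w) = 0) :
    ∀ᶠ q in 𝓝 z, ∀ v, fderiv 𝕜 f (σ q) v = 0 → ∃ u, v = fderiv 𝕜 σ q u := by
  have : CompleteSpace F := FiniteDimensional.complete 𝕜 F
  have hker := ker_eq_range hsurj hr
    (fderiv_comp_eq_zero (hσ.differentiableAt (by simp)) rfl (hf.differentiableAt (by simp)) h0)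
  obtain ⟨R, hR⟩ := (fderiv 𝕜 f (σ z) : F →ₗ[𝕜] (Fin k → 𝕜)).exists_rightInverse_of_surjective
    (LinearMap.range_eq_top.2 hsurj)
  let Rc : (Fin k → 𝕜) →L[𝕜] F := R.toContinuousLinearMap
  have hRc : ∀ y, fderiv 𝕜 f (σ z) (Rc y) = y := fun y => LinearMap.congr_fun hR y
  obtain ⟨A, hA, -⟩ := exists_reflexive_generalized_inverse (fderiv 𝕜 σ z)
  have cσ : ContinuousAt (fderiv 𝕜 σ) z := (hσ.fderiv_right (m := ∞) (by simp)).continuousAt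
  have cf : ContinuousAt (fun q => fderiv 𝕜 f (σ q)) z :=
    ContinuousAt.comp (f := σ) (hf.fderiv_right (m := ∞) (by simp)).continuousAt hσ.continuousAt
  -- `v - R (df v)` lies in the range of `dσ` at `z`, so `A` inverts `dσ` on it
  let P : F →L[𝕜] F := ContinuousLinearMap.id 𝕜 F - Rc.comp (fderiv 𝕜 f (σ z))
  have e1 : ∀ᶠ q in 𝓝 z, Function.Bijective
      ((fderiv 𝕜 σ q).comp (A.comp P) + Rc.comp (fderiv 𝕜 f (σ z))) := by
    refine eventually_isUnit ?_ ?_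
    · exact (cσ.clm_comp continuousAt_const).add continuousAt_const
    · ext v
      have hv : P v ∈ (fderiv 𝕜 σ z : E →ₗ[𝕜] F).range := by
        rw [hker]
        simp [P, hRc]
      obtain ⟨u, hu⟩ := hv
      have hu' : fderiv 𝕜 σ z u = P v := hu
      change fderiv 𝕜 σ z (A (P v)) + Rc (fderiv 𝕜 f (σ z) v) = v
      rw [← hu', hA, hu']
      simp [P]
  have e2 : ∀ᶠ q in 𝓝 z, Function.Bijective ((fderiv 𝕜 f (σ q)).comp Rc) := by
    refine eventually_isUnit (cf.clm_comp continuousAt_const) ?_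
    ext1 y
    exact hRc y
  filter_upwards [e1, e2, h0.eventually_nhds, hσ.of_le (m := 1) (by simp) |>.eventually (by simp),
    hσ.continuousAt.eventually (hf.of_le (m := 1) (by simp) |>.eventually (by simp))]
    with q h1 h2 h3 h4 h5 v hv
  obtain ⟨w, hw⟩ := h1.2 v
  have hw' : fderiv 𝕜 σ q (A (P w)) + Rc (fderiv 𝕜 f (σ z) w) = v := hw
  have h6 := fderiv_comp_eq_zero (h4.differentiableAt (by simp)) rfl
    (h5.differentiableAt (by simp)) h3 (A (P w))
  rw [← hw', map_add, h6, zero_add] at hv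
  have h7 : fderiv 𝕜 f (σ z) w = 0 := h2.1 (by simpa using hv)
  exact ⟨A (P w), by rw [← hw', h7, map_zero, add_zero]⟩

/-- A map `σ` into a level set of `f`, with full rank at `z`, has a smooth local section over the
level set. -/
theorem exists_local_section (hσ : ContDiffAt 𝕜 ∞ σ z) (hf : ContDiffAt 𝕜 ∞ f (σ z))
    (hsurj : Function.Surjective (fderiv 𝕜 f (σ z)))
    (hr : Module.finrank 𝕜 (fderiv 𝕜 σ z : E →ₗ[𝕜] F).range + k = Module.finrank 𝕜 F)
    (h0 : ∀ᶠ w in 𝓝 z, f (σ w) = 0) :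
    ∃ θ : F → E, ContDiffAt 𝕜 ∞ θ (σ z) ∧ θ (σ z) = z ∧
      ∀ᶠ x in 𝓝 (σ z), f x = 0 → σ (θ x) = x := by
  have : CompleteSpace F := FiniteDimensional.complete 𝕜 F
  have : CompleteSpace E := FiniteDimensional.complete 𝕜 E
  have dσ := hσ.differentiableAt (by simp)
  have hker := ker_eq_range hsurj hr
    (fderiv_comp_eq_zero dσ rfl (hf.differentiableAt (by simp)) h0)
  set L := fderiv 𝕜 σ z with hL
  set M := fderiv 𝕜 f (σ z) with hM
  obtain ⟨A, hA, hA'⟩ := exists_reflexive_generalized_inverse L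
  -- `Ψ` has derivative `1` at `z`; the term `1 - A L` completes `A ∘ σ` to a local
  -- diffeomorphism
  let Ψ : E → E := fun u => A (σ u - σ z) + ((u - z) - A (L (u - z)))
  have hΨs : ContDiffAt 𝕜 ∞ Ψ z := by
    have : ContDiffAt 𝕜 ∞ (fun u => A (σ u - σ z)) z :=
      A.contDiff.contDiffAt.comp z (hσ.sub contDiffAt_const)
    have h2 : ContDiffAt 𝕜 ∞ (fun u => (u - z) - A (L (u - z))) z := by fun_prop
    exact this.add h2
  have hΨd : HasFDerivAt Ψ ((ContinuousLinearEquiv.refl 𝕜 E : E ≃L[𝕜] E) : E →L[𝕜] E) z := by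
    have h1 : HasFDerivAt (fun u => A (σ u - σ z)) (A.comp L) z :=
      A.hasFDerivAt.comp z (dσ.hasFDerivAt.sub_const _)
    have h2 : HasFDerivAt (fun u : E => u - z) (ContinuousLinearMap.id 𝕜 E) z :=
      (hasFDerivAt_id z).sub_const z
    have h3 : HasFDerivAt (fun u => A (L (u - z))) (A.comp L) z :=
      (A.comp L).hasFDerivAt.comp z h2
    refine (h1.add (h2.sub h3)).congr_fderiv ?_
    ext u
    simp
  have hn : (∞ : WithTop ℕ∞) ≠ 0 := by simp
  have hΨz : Ψ z = 0 := by simp [Ψ]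
  let η := hΨs.localInverse hΨd hn
  have hη : ContDiffAt 𝕜 ∞ η 0 := hΨz ▸ hΨs.to_localInverse hΨd hn
  have hη0 : η 0 = z := hΨz ▸ hΨs.localInverse_apply_image hΨd hn
  have hηr : ∀ᶠ y in 𝓝 0, Ψ (η y) = y := by
    have := (hΨs.hasStrictFDerivAt' hΨd hn).eventually_right_inverse
    rw [hΨz] at this
    exact this
  have cA : ContDiffAt 𝕜 ∞ (fun x => A (x - σ z)) (σ z) := by fun_prop
  have hθ : ContDiffAt 𝕜 ∞ (fun x => η (A (x - σ z))) (σ z) := by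
    refine ContDiffAt.comp (g := η) (σ z) ?_ cA
    simpa using hη
  have hθz : η (A (σ z - σ z)) = z := by simpa using hη0
  refine ⟨fun x => η (A (x - σ z)), hθ, hθz, ?_⟩
  -- `x ↦ (A x, f x)` is injective near `σ z`
  have hinj : ((A.prod M : F →L[𝕜] E × (Fin k → 𝕜)) : F →ₗ[𝕜] E × (Fin k → 𝕜)).ker = ⊥ := by
    rw [LinearMap.ker_eq_bot']
    intro v hv
    have hv1 : A v = 0 := congrArg Prod.fst hv
    have hv2 : v ∈ (M : F →ₗ[𝕜] (Fin k → 𝕜)).ker := congrArg Prod.snd hv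
    rw [← hker] at hv2
    obtain ⟨u, rfl⟩ := hv2
    have := hA u
    change A (L u) = 0 at hv1
    rw [hv1, map_zero] at this
    exact this.symm
  obtain ⟨B, hB⟩ := LinearMap.exists_leftInverse_of_injective _ hinj
  let Bc : E × (Fin k → 𝕜) →L[𝕜] F := B.toContinuousLinearMap
  have hΦ : HasStrictFDerivAt (fun x => Bc (A x, f x))
      ((ContinuousLinearEquiv.refl 𝕜 F : F ≃L[𝕜] F) : F →L[𝕜] F) (σ z) := by
    have h1 : HasStrictFDerivAt (fun x => (A x, f x)) (A.prod M) (σ z) :=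
      A.hasStrictFDerivAt.prodMk (hf.hasStrictFDerivAt hn)
    refine (Bc.hasStrictFDerivAt.comp (σ z) h1).congr_fderiv ?_
    ext v
    exact LinearMap.congr_fun hB v
  let T := hΦ.toOpenPartialHomeomorph _
  have hT : T.source ∈ 𝓝 (σ z) := T.open_source.mem_nhds hΦ.mem_toOpenPartialHomeomorph_source
  have hθc : Tendsto (fun x => η (A (x - σ z))) (𝓝 (σ z)) (𝓝 z) := by
    have := hθ.continuousAt.tendsto
    rwa [hθz] at this
  have cA0 : Tendsto (fun x => A (x - σ z)) (𝓝 (σ z)) (𝓝 0) := by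
    have := cA.continuousAt.tendsto
    simpa using this
  filter_upwards [hT, hθc.eventually (hσ.continuousAt.eventually_mem hT), hθc.eventually h0,
    cA0.eventually hηr] with x hx1 hx2 hx3 hx4 hx5
  refine T.injOn hx2 hx1 ?_
  change Bc (A (σ (η (A (x - σ z)))), f (σ (η (A (x - σ z))))) = Bc (A x, f x)
  rw [hx3, hx5]
  set u := η (A (x - σ z))
  have h1 : A (σ u - σ z) + ((u - z) - A (L (u - z))) = A (x - σ z) := hx4
  have h2 := congrArg (fun v => A (L v)) h1
  simp only [map_add, map_sub, hA', hA] at h2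
  have h3 : A (σ u) = A x := by
    have := h2
    simp only [sub_self, add_zero] at this
    exact sub_left_injective this
  rw [h3]

end LocalSection

/-! ### Derivatives of the signature as functions of the signature -/

/-- The nine components of the signature, arranged as three families indexed by `Fin 3`. -/
theorem forall_signature_iff (m m' : Fin 3 → 𝕜 × 𝕜 → 𝕜)
    (P : (𝕜 × 𝕜 → 𝕜) → (𝕜 × 𝕜 → 𝕜) → Prop) :
    (∀ k, P (fun w => signature m w k) (fun w => signature m' w k)) ↔
      (∀ j, P (inv m j) (inv m' j)) ∧
      (∀ j, P (del m (j + 1) (inv m j)) (del m' (j + 1) (inv m' j))) ∧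
      (∀ j, P (del m (j + 1) (del m (j + 1) (inv m j)))
        (del m' (j + 1) (del m' (j + 1) (inv m' j)))) := by
  constructor
  · intro h
    refine ⟨fun j => ?_, fun j => ?_, fun j => ?_⟩
    · fin_cases j
      exacts [h 0, h 1, h 2]
    · fin_cases j
      exacts [h 3, h 4, h 5]
    · fin_cases j
      exacts [h 6, h 7, h 8]
  · rintro ⟨h0, h1, h2⟩ k
    fin_cases k
    exacts [h0 0, h0 1, h0 2, h1 0, h1 1, h1 2, h2 0, h2 1, h2 2]

theorem signature_eq_iff {m m' : Fin 3 → 𝕜 × 𝕜 → 𝕜} {z z' : 𝕜 × 𝕜} :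
    signature m z = signature m' z' ↔
      (∀ j, inv m j z = inv m' j z') ∧
      (∀ j, del m (j + 1) (inv m j) z = del m' (j + 1) (inv m' j) z') ∧
      (∀ j, del m (j + 1) (del m (j + 1) (inv m j)) z =
        del m' (j + 1) (del m' (j + 1) (inv m' j)) z') :=
  funext_iff.trans (forall_signature_iff m m' fun f f' => f z = f' z')

namespace LinearSlopes

variable {m m' : Fin 3 → 𝕜 × 𝕜 → 𝕜} {U U' : Set (𝕜 × 𝕜)} {z z' : 𝕜 × 𝕜}

theorem fderiv_signature_apply (hm : LinearSlopes m U) (hz : z ∈ U) (hd : den m z ≠ 0)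
    (u : 𝕜 × 𝕜) (k : Fin 9) :
    fderiv 𝕜 (signature m) z u k = fderiv 𝕜 (fun w => signature m w k) z u := by
  have h := (hm.contDiffAt_signature hz hd).differentiableAt (by simp)
  exact congrArg (fun l => l u) (fderiv_apply h k).symm

/-- The derivatives of the signature along the invariant frame are the same functions of the
signature for two webs with the same signature set near a point. Here `f = 0` defines the signature
set, and `θ` is a local section of the signature map of the second web. Both derivatives are
tangent to the signature set and agree in the six components of order at most one; at the points of
`exists_mem_ker_le` this makes them equal, and these points are dense. -/
theorem eventually_fderiv_signature_frame_eq {k : ℕ} (hm : LinearSlopes m U) (hz : z ∈ U)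
    (hd : den m z ≠ 0) (hm' : LinearSlopes m' U') (hz' : z' ∈ U') (hd' : den m' z' ≠ 0)
    {f : (Fin 9 → 𝕜) → Fin k → 𝕜} (hf : ContDiffAt 𝕜 ∞ f (signature m z))
    (hsurj : Function.Surjective (fderiv 𝕜 f (signature m z)))
    (hr : Module.finrank 𝕜 (fderiv 𝕜 (signature m) z : 𝕜 × 𝕜 →ₗ[𝕜] (Fin 9 → 𝕜)).range + k =
      Module.finrank 𝕜 (Fin 9 → 𝕜))
    (h0 : ∀ᶠ w in 𝓝 z, f (signature m w) = 0) (h0' : ∀ᶠ w in 𝓝 z', f (signature m' w) = 0)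
    {θ : (Fin 9 → 𝕜) → 𝕜 × 𝕜} (hθ : ContDiffAt 𝕜 ∞ θ (signature m z))
    (hθz : θ (signature m z) = z')
    (hθs : ∀ᶠ q in 𝓝 z, signature m' (θ (signature m q)) = signature m q) :
    ∀ᶠ q in 𝓝 z, ∀ i, fderiv 𝕜 (signature m) q (frame m i q) =
      fderiv 𝕜 (signature m') (θ (signature m q)) (frame m' i (θ (signature m q))) := by
  have hσ := hm.contDiffAt_signature hz hd
  have hτ : Tendsto (fun q => θ (signature m q)) (𝓝 z) (𝓝 z') := by
    have := (ContinuousAt.comp (f := signature m) hθ.continuousAt hσ.continuousAt).tendsto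
    simpa only [Function.comp_apply, Function.comp_def, hθz] using this
  have hev := (hm.eventually_den_ne hz hd).and <| (hτ.eventually (hm'.eventually_den_ne hz' hd')).and
    <| (hσ.continuousAt.eventually ((hθ.of_le (m := 1) (by simp)).eventually (by simp))).and <|
    (hσ.continuousAt.eventually ((hf.of_le (m := 1) (by simp)).eventually (by simp))).and <|
    (eventually_ker_le_range hσ hf hsurj hr h0).and <| h0.eventually_nhds.and <|
    (hτ.eventually h0'.eventually_nhds).and hθs
  obtain ⟨O, hO, hOo, hzO⟩ := eventually_nhds_iff.1 hev
  filter_upwards [hOo.mem_nhds hzO] with q₀ hq₀ i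
  by_contra hne
  -- the set of points of `O` where the two derivatives differ is open
  have hcont : ContinuousAt (fun q => fderiv 𝕜 (signature m) q (frame m i q) -
      fderiv 𝕜 (signature m') (θ (signature m q)) (frame m' i (θ (signature m q)))) q₀ := by
    obtain ⟨⟨a1, a2⟩, ⟨b1, b2⟩, c, -⟩ := hO q₀ hq₀
    have e1 := (hm.contDiffAt_signature a1 a2)
    have e2 := (hm'.contDiffAt_signature b1 b2)
    have c1 := ((e1.fderiv_right (m := ∞) (by simp)).clm_apply
      (hm.contDiffAt_frame a1 a2 i)).continuousAt
    have c2 := ((e2.fderiv_right (m := ∞) (by simp)).clm_apply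
      (hm'.contDiffAt_frame b1 b2 i)).continuousAt
    have c3 : ContinuousAt (fun q => θ (signature m q)) q₀ :=
      ContinuousAt.comp (f := signature m) c.continuousAt e1.continuousAt
    exact c1.sub (ContinuousAt.comp (f := fun q => θ (signature m q)) c2 c3)
  have hev2 := (hcont.eventually_ne (sub_ne_zero.2 hne)).and (hOo.eventually_mem hq₀)
  obtain ⟨O₁, hO₁, hO₁o, hq₁⟩ := eventually_nhds_iff.1 hev2
  obtain ⟨q, hq, hgood⟩ := hm.exists_mem_ker_le hO₁o ⟨q₀, hq₁⟩
    (fun q hq => (hO q (hO₁ q hq).2).1)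
  obtain ⟨hneq, hqO⟩ := hO₁ q hq
  obtain ⟨⟨a1, a2⟩, ⟨b1, b2⟩, -, d, e, g, g', s⟩ := hO q hqO
  have t1 := fderiv_comp_eq_zero ((hm.contDiffAt_signature a1 a2).differentiableAt (by simp)) rfl
    (d.differentiableAt (by simp)) g (frame m i q)
  have t2 := fderiv_comp_eq_zero ((hm'.contDiffAt_signature b1 b2).differentiableAt (by simp)) s
    (d.differentiableAt (by simp)) g' (frame m' i (θ (signature m q)))
  obtain ⟨u, hu⟩ := e _ (by rw [map_sub, t1, t2, sub_zero] :
    fderiv 𝕜 f (signature m q) (fderiv 𝕜 (signature m) q (frame m i q) -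
      fderiv 𝕜 (signature m') (θ (signature m q)) (frame m' i (θ (signature m q)))) = 0)
  obtain ⟨s0, s1, s2⟩ := signature_eq_iff.1 s.symm
  have key : ∀ l, fderiv 𝕜 (fun w => signature m w l) q u =
      fderiv 𝕜 (fun w => signature m w l) q (frame m i q) -
      fderiv 𝕜 (fun w => signature m' w l) (θ (signature m q))
        (frame m' i (θ (signature m q))) := by
    intro l
    have := congrFun hu l
    rw [Pi.sub_apply, hm.fderiv_signature_apply a1 a2, hm'.fderiv_signature_apply b1 b2,
      hm.fderiv_signature_apply a1 a2] at this
    exact this.symm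
  obtain ⟨k0, k1, -⟩ := (forall_signature_iff m m' fun h h' => fderiv 𝕜 h q u =
    fderiv 𝕜 h q (frame m i q) - fderiv 𝕜 h' (θ (signature m q))
      (frame m' i (θ (signature m q)))).1 key
  have u0 : ∀ j, fderiv 𝕜 (inv m j) q u = 0 := fun j => by
    rw [k0, sub_eq_zero]
    exact hm.del_inv_congr a1 a2 hm' b1 b2 s0 s1 i j
  have u1 : ∀ j, fderiv 𝕜 (del m (j + 1) (inv m j)) q u = 0 := fun j => by
    rw [k1, sub_eq_zero]
    exact hm.del_del_inv_congr a1 a2 hm' b1 b2 s0 s1 s2 i j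
  apply hneq
  rw [hu]
  funext l
  rw [hm.fderiv_signature_apply a1 a2]
  exact (forall_signature_iff m m fun h _ => fderiv 𝕜 h q u = 0).2 ⟨u0, u1, hgood u u0 u1⟩ l

end LinearSlopes

/-! ### Uniqueness from the total differential equation for the 1-jet -/

/-- Uniqueness for total differential equations `dw = Φ(w)` with Lipschitz right-hand side. -/
theorem eventuallyEq_of_fderiv_eq {E : Type*} [NormedAddCommGroup E] [NormedSpace 𝕜 E]
    {w w' : 𝕜 × 𝕜 → E} {z : 𝕜 × 𝕜} {Φ : E → 𝕜 × 𝕜 →L[𝕜] E} {K : NNReal} {t : Set E}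
    (ht : t ∈ 𝓝 (w z)) (hΦ : LipschitzOnWith K Φ t) (hz : w z = w' z)
    (hw : ∀ᶠ q in 𝓝 z, HasFDerivAt w (Φ (w q)) q)
    (hw' : ∀ᶠ q in 𝓝 z, HasFDerivAt w' (Φ (w' q)) q) : w =ᶠ[𝓝 z] w' := by
  have c : ContinuousAt w z := hw.self_of_nhds.continuousAt
  have c' : ContinuousAt w' z := hw'.self_of_nhds.continuousAt
  obtain ⟨ε, hε, hball⟩ := Metric.eventually_nhds_iff_ball.1
    ((hw.and hw').and ((c.eventually_mem ht).and (c'.eventually_mem (hz ▸ ht))))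
  obtain ⟨ρ, hρ, hρε, hKρ⟩ : ∃ ρ > 0, ρ < ε ∧ K * ρ < 1 := by
    refine ⟨min (ε / 2) (1 / (2 * (K + 1))), by positivity,
      (min_le_left _ _).trans_lt (by linarith), ?_⟩
    have hK : (0 : ℝ) ≤ K := K.2
    calc (K : ℝ) * min (ε / 2) (1 / (2 * (K + 1))) ≤ K * (1 / (2 * (K + 1))) := by
          gcongr
          exact min_le_right _ _
      _ < 1 := by
          rw [mul_one_div, div_lt_one (by positivity)]
          linarith
  have hsub : Metric.closedBall z ρ ⊆ Metric.ball z ε := Metric.closedBall_subset_ball hρε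
  have hd : ∀ q ∈ Metric.closedBall z ρ,
      HasFDerivAt (fun q => w q - w' q) (Φ (w q) - Φ (w' q)) q := fun q hq =>
    (hball q (hsub hq)).1.1.sub (hball q (hsub hq)).1.2
  obtain ⟨q, hq, hmax⟩ := (isCompact_closedBall z ρ).exists_isMaxOn
    ⟨z, Metric.mem_closedBall_self hρ.le⟩
    (f := fun q => ‖w q - w' q‖) (fun q hq => (hd q hq).continuousAt.norm.continuousWithinAt)
  have hbound : ∀ p ∈ Metric.closedBall z ρ,
      ‖fderiv 𝕜 (fun q => w q - w' q) p‖ ≤ K * ‖w q - w' q‖ := by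
    intro p hp
    rw [(hd p hp).fderiv]
    refine (hΦ.norm_sub_le (hball p (hsub hp)).2.1 (hball p (hsub hp)).2.2).trans ?_
    exact mul_le_mul_of_nonneg_left (hmax hp) K.2
  have hmv := (convex_closedBall z ρ).norm_image_sub_le_of_norm_fderiv_le
    (fun p hp => (hd p hp).differentiableAt) hbound (Metric.mem_closedBall_self hρ.le) hq
  rw [hz, sub_self, sub_zero] at hmv
  have hqz : ‖q - z‖ ≤ ρ := by simpa [dist_eq_norm] using hq
  have h0 : ‖w q - w' q‖ = 0 := by
    by_contra hne
    have hpos : 0 < ‖w q - w' q‖ := lt_of_le_of_ne (norm_nonneg _) (Ne.symm hne)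
    have : K * ‖w q - w' q‖ * ‖q - z‖ ≤ K * ‖w q - w' q‖ * ρ := by gcongr
    nlinarith
  filter_upwards [Metric.closedBall_mem_nhds z hρ] with p hp
  have := hmax hp
  simp only [Set.mem_ofPred_eq] at this
  rw [h0] at this
  exact sub_eq_zero.1 (norm_le_zero_iff.1 this)

/-- The space of values of `(P, Q, R)`, of `(P_y, Q_y, R_y)` and of the signature. -/
abbrev JetSpace (𝕜 : Type*) [RCLike 𝕜] : Type _ := (Fin 3 → 𝕜) × (Fin 3 → 𝕜) × (Fin 9 → 𝕜)

/-- The slopes, their first derivatives and the signature. -/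
def jet (m : Fin 3 → 𝕜 × 𝕜 → 𝕜) (z : 𝕜 × 𝕜) : JetSpace 𝕜 :=
  (fun i => m i z, fun i => dY (m i) z, signature m z)

/-- `den` as a function of the jet. -/
def jetDen (w : JetSpace 𝕜) : 𝕜 :=
  w.2.1 0 * (w.1 2 - w.1 1) + w.2.1 1 * (w.1 0 - w.1 2) + w.2.1 2 * (w.1 1 - w.1 0)

/-- The second derivatives of the slopes as functions of the jet. -/
def jetSecond (w : JetSpace 𝕜) (i : Fin 3) : 𝕜 :=
  ![w.2.2 0, w.2.2 1, w.2.2 2] i * jetDen w ^ 2 /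
    ((w.1 0 - w.1 1) * (w.1 0 - w.1 2) * (w.1 2 - w.1 1))

/-- The derivative of the signature along `(v₁, v₂)` as a function of the jet, if the derivative
along the `i`-th vector field of the frame is the function `H i` of the signature. -/
def jetSignature (H : Fin 3 → (Fin 9 → 𝕜) → Fin 9 → 𝕜) (v₁ v₂ : 𝕜) (w : JetSpace 𝕜) :
    Fin 9 → 𝕜 :=
  ((v₂ - v₁ * w.1 1) * jetDen w / ((w.1 0 - w.1 1) * (w.1 1 - w.1 2))) • H 0 w.2.2 +
    ((v₁ * w.1 0 - v₂) * jetDen w / ((w.1 0 - w.1 1) * (w.1 2 - w.1 0))) • H 1 w.2.2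

/-- The derivative of the jet along `(v₁, v₂)` as a function of the jet. -/
def jetField (H : Fin 3 → (Fin 9 → 𝕜) → Fin 9 → 𝕜) (v₁ v₂ : 𝕜) (w : JetSpace 𝕜) : JetSpace 𝕜 :=
  (fun i => (v₂ - v₁ * w.1 i) * w.2.1 i,
    fun i => (v₂ - v₁ * w.1 i) * jetSecond w i - v₁ * w.2.1 i ^ 2, jetSignature H v₁ v₂ w)

theorem contDiffAt_jetField {H : Fin 3 → (Fin 9 → 𝕜) → Fin 9 → 𝕜} {w : JetSpace 𝕜} (v₁ v₂ : 𝕜)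
    (hw : ∀ i j, i ≠ j → w.1 i ≠ w.1 j) (hH : ∀ i, ContDiffAt 𝕜 1 (H i) w.2.2) :
    ContDiffAt 𝕜 1 (jetField H v₁ v₂) w := by
  have h01 := sub_ne_zero.2 (hw 0 1 (by decide))
  have h02 := sub_ne_zero.2 (hw 0 2 (by decide))
  have h20 := sub_ne_zero.2 (hw 2 0 (by decide))
  have h12 := sub_ne_zero.2 (hw 1 2 (by decide))
  have h21 := sub_ne_zero.2 (hw 2 1 (by decide))
  have p : ∀ i, ContDiffAt 𝕜 1 (fun w : JetSpace 𝕜 => w.1 i) w := fun i => by fun_prop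
  have p1 : ∀ i, ContDiffAt 𝕜 1 (fun w : JetSpace 𝕜 => w.2.1 i) w := fun i => by fun_prop
  have p2 : ∀ i, ContDiffAt 𝕜 1 (fun w : JetSpace 𝕜 => w.2.2 i) w := fun i => by fun_prop
  have hD : ContDiffAt 𝕜 1 (jetDen (𝕜 := 𝕜)) w := by unfold jetDen; fun_prop
  have hs : ∀ i, ContDiffAt 𝕜 1 (fun w : JetSpace 𝕜 => jetSecond w i) w := fun i => by
    have : ContDiffAt 𝕜 1 (fun w : JetSpace 𝕜 => ![w.2.2 0, w.2.2 1, w.2.2 2] i) w := by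
      fin_cases i
      exacts [p2 0, p2 1, p2 2]
    refine (this.mul (hD.pow 2)).div ?_ (by simp [h01, h02, h21])
    fun_prop
  have hH' : ∀ i, ContDiffAt 𝕜 1 (fun w : JetSpace 𝕜 => H i w.2.2) w := fun i =>
    ContDiffAt.comp w (g := H i) (f := fun w : JetSpace 𝕜 => w.2.2) (hH i) (by fun_prop)
  have hS : ContDiffAt 𝕜 1 (jetSignature H v₁ v₂) w := by
    refine ContDiffAt.add (ContDiffAt.smul (ContDiffAt.div ?_ ?_ ?_) (hH' 0))
      (ContDiffAt.smul (ContDiffAt.div ?_ ?_ ?_) (hH' 1))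
    · fun_prop
    · fun_prop
    · simp [h01, h12]
    · fun_prop
    · fun_prop
    · simp [h01, h20]
  refine ContDiffAt.prodMk ?_ (ContDiffAt.prodMk ?_ hS)
  · fun_prop
  · rw [contDiffAt_pi]
    intro i
    have := hs i
    fun_prop

namespace LinearSlopes

variable {m : Fin 3 → 𝕜 × 𝕜 → 𝕜} {U : Set (𝕜 × 𝕜)} {z : 𝕜 × 𝕜}

theorem hasFDerivAt_jet (hm : LinearSlopes m U) (hz : z ∈ U) (hd : den m z ≠ 0)
    {H : Fin 3 → (Fin 9 → 𝕜) → Fin 9 → 𝕜}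
    (hH : ∀ i, fderiv 𝕜 (signature m) z (frame m i z) = H i (signature m z)) :
    HasFDerivAt (jet m) ((ContinuousLinearMap.fst 𝕜 𝕜 𝕜).smulRight (jetField H 1 0 (jet m z)) +
      (ContinuousLinearMap.snd 𝕜 𝕜 𝕜).smulRight (jetField H 0 1 (jet m z))) z := by
  have h01 := sub_ne_zero.2 (hm.ne z hz 0 1 (by decide))
  have h02 := sub_ne_zero.2 (hm.ne z hz 0 2 (by decide))
  have h20 := sub_ne_zero.2 (hm.ne z hz 2 0 (by decide))
  have h12 := sub_ne_zero.2 (hm.ne z hz 1 2 (by decide))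
  have h21 := sub_ne_zero.2 (hm.ne z hz 2 1 (by decide))
  have hD : jetDen (jet m z) = den m z := by
    rw [den_eq m 0]
    rfl
  have h1 : HasFDerivAt (fun z i => m i z) _ z :=
    hasFDerivAt_pi.2 fun i => (hm.differentiableAt hz i).hasFDerivAt
  have h2 : HasFDerivAt (fun z i => dY (m i) z) _ z :=
    hasFDerivAt_pi.2 fun i => (hm.differentiableAt_dY hz i).hasFDerivAt
  have h3 : HasFDerivAt (signature m) _ z :=
    ((hm.contDiffAt_signature hz hd).differentiableAt (by simp)).hasFDerivAt
  have hs : ∀ i, jetSecond (jet m z) i = dY (dY (m i)) z := by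
    intro i
    have e : ![(jet m z).2.2 0, (jet m z).2.2 1, (jet m z).2.2 2] i = inv m i z := by
      fin_cases i <;> rfl
    rw [jetSecond, e, hD]
    simp only [inv_eq_weight_mul, weight]
    simp only [jet]
    field_simp
  have hfr : ∀ v : 𝕜 × 𝕜, v =
      ((v.2 - v.1 * m 1 z) * den m z / ((m 0 z - m 1 z) * (m 1 z - m 2 z))) • frame m 0 z +
      ((v.1 * m 0 z - v.2) * den m z / ((m 0 z - m 1 z) * (m 2 z - m 0 z))) • frame m 1 z := by
    intro v
    have e0 : frame m 0 z = ((m 1 z - m 2 z) / den m z) • ((1 : 𝕜), m 0 z) := rfl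
    have e1 : frame m 1 z = ((m 2 z - m 0 z) / den m z) • ((1 : 𝕜), m 1 z) := rfl
    rw [e0, e1]
    ext
    · simp
      field_simp
      ring
    · simp
      field_simp
      ring
  have hS : ∀ v : 𝕜 × 𝕜, fderiv 𝕜 (signature m) z v = jetSignature H v.1 v.2 (jet m z) := by
    intro v
    conv_lhs => rw [hfr v]
    rw [map_add, map_smul, map_smul, hH, hH, jetSignature, hD]
    rfl
  refine (h1.prodMk (h2.prodMk h3)).congr_fderiv ?_
  ext i
  · simp [hm.fderiv_slope hz, jetField, jet]
  · simp [hm.fderiv_dY hz, jetField, hs]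
    simp [jet]
  · simp [jetField, hS]
  · simp [hm.fderiv_slope hz, jetField, jet]
  · simp [hm.fderiv_dY hz, jetField, hs]
  · simp [jetField, hS]

/-- Two webs with the same 1-jet of slopes and the same signature at a point coincide near it if
the derivatives of their signatures along the frames are the same functions of the signature. -/
theorem eventually_eq_of_jet_eq {m' : Fin 3 → 𝕜 × 𝕜 → 𝕜} {U' : Set (𝕜 × 𝕜)}
    (hm : LinearSlopes m U) (hz : z ∈ U) (hd : den m z ≠ 0)
    (hm' : LinearSlopes m' U') (hz' : z ∈ U') (hd' : den m' z ≠ 0) (hj : jet m z = jet m' z)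
    {H : Fin 3 → (Fin 9 → 𝕜) → Fin 9 → 𝕜} (hHs : ∀ i, ContDiffAt 𝕜 1 (H i) (signature m z))
    (hH : ∀ᶠ q in 𝓝 z, ∀ i, fderiv 𝕜 (signature m) q (frame m i q) = H i (signature m q))
    (hH' : ∀ᶠ q in 𝓝 z, ∀ i, fderiv 𝕜 (signature m') q (frame m' i q) = H i (signature m' q)) :
    ∀ᶠ q in 𝓝 z, ∀ i, m i q = m' i q := by
  have hc : ∀ v₁ v₂, ContDiffAt 𝕜 1 (jetField H v₁ v₂) (jet m z) := fun v₁ v₂ =>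
    contDiffAt_jetField v₁ v₂ (hm.ne z hz) hHs
  have hΦ : ContDiffAt 𝕜 1 (fun w => (ContinuousLinearMap.fst 𝕜 𝕜 𝕜).smulRight (jetField H 1 0 w) +
      (ContinuousLinearMap.snd 𝕜 𝕜 𝕜).smulRight (jetField H 0 1 w)) (jet m z) :=
    (contDiffAt_const.smulRight (hc 1 0)).add (contDiffAt_const.smulRight (hc 0 1))
  obtain ⟨K, t, ht, hK⟩ := hΦ.exists_lipschitzOnWith
  have := eventuallyEq_of_fderiv_eq ht hK hj
    ((hm.eventually_den_ne hz hd).and hH |>.mono fun q hq =>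
      hm.hasFDerivAt_jet hq.1.1 hq.1.2 hq.2)
    ((hm'.eventually_den_ne hz' hd').and hH' |>.mono fun q hq =>
      hm'.hasFDerivAt_jet hq.1.1 hq.1.2 hq.2)
  filter_upwards [this] with q hq i
  exact congrFun (congrArg Prod.fst hq) i

end LinearSlopes

/-! ### Projective changes of the affine chart -/

section ChartMap

/-- The homogeneous coordinates of the image of an affine point under the matrix `c`. -/
def linForm (c : Matrix (Fin 3) (Fin 3) 𝕜) (i : Fin 3) (z : 𝕜 × 𝕜) : 𝕜 :=
  c i 0 * z.1 + c i 1 * z.2 + c i 2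

/-- The projective transformation with matrix `c` in affine coordinates. -/
def chartMap (c : Matrix (Fin 3) (Fin 3) 𝕜) (z : 𝕜 × 𝕜) : 𝕜 × 𝕜 :=
  (linForm c 0 z / linForm c 2 z, linForm c 1 z / linForm c 2 z)

/-- The numerators of the partial derivatives of `chartMap c`. -/
def jacNum (c : Matrix (Fin 3) (Fin 3) 𝕜) (i j : Fin 3) (z : 𝕜 × 𝕜) : 𝕜 :=
  linForm c 2 z * c i j - linForm c i z * c 2 j

/-- This vanishes if `chartMap c` carries the vertical direction at `z` to the direction of
slope `k`. -/
def slopeDen (c : Matrix (Fin 3) (Fin 3) 𝕜) (k : 𝕜) (z : 𝕜 × 𝕜) : 𝕜 :=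
  jacNum c 1 1 z - k * jacNum c 0 1 z

/-- The slopes of the preimage under `chartMap c` of the foliations with slopes `m`. -/
def pullSlope (c : Matrix (Fin 3) (Fin 3) 𝕜) (m : Fin 3 → 𝕜 × 𝕜 → 𝕜) (i : Fin 3)
    (z : 𝕜 × 𝕜) : 𝕜 :=
  (m i (chartMap c z) * jacNum c 0 0 z - jacNum c 1 0 z) / slopeDen c (m i (chartMap c z)) z

/-- The set on which `pullSlope c m` is meaningful: the points that `chartMap c` maps to `U`, and at
which none of the pulled back lines is vertical. -/
def pullDomain (c : Matrix (Fin 3) (Fin 3) 𝕜) (m : Fin 3 → 𝕜 × 𝕜 → 𝕜) (U : Set (𝕜 × 𝕜)) :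
    Set (𝕜 × 𝕜) :=
  {z | linForm c 2 z ≠ 0 ∧ chartMap c z ∈ U ∧ ∀ i, slopeDen c (m i (chartMap c z)) z ≠ 0}

variable {c : Matrix (Fin 3) (Fin 3) 𝕜} {z : 𝕜 × 𝕜}

theorem contDiff_linForm (i : Fin 3) : ContDiff 𝕜 ∞ (linForm c i) := by
  unfold linForm; fun_prop

theorem contDiffAt_chartMap (h : linForm c 2 z ≠ 0) : ContDiffAt 𝕜 ∞ (chartMap c) z :=
  ((contDiff_linForm 0).contDiffAt.div (contDiff_linForm 2).contDiffAt h).prodMk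
    ((contDiff_linForm 1).contDiffAt.div (contDiff_linForm 2).contDiffAt h)

theorem contDiff_jacNum (i j : Fin 3) : ContDiff 𝕜 ∞ (jacNum c i j) := by
  have := fun i => contDiff_linForm (c := c) i
  unfold jacNum; fun_prop

theorem hasDerivAt_linForm (c : Matrix (Fin 3) (Fin 3) 𝕜) (i : Fin 3) (z v : 𝕜 × 𝕜) :
    HasDerivAt (fun t : 𝕜 => linForm c i (z + t • v)) (c i 0 * v.1 + c i 1 * v.2) 0 := by
  have h1 : HasDerivAt (fun t : 𝕜 => z.1 + t * v.1) v.1 0 := by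
    simpa using ((hasDerivAt_id (0 : 𝕜)).mul_const v.1).const_add z.1
  have h2 : HasDerivAt (fun t : 𝕜 => z.2 + t * v.2) v.2 0 := by
    simpa using ((hasDerivAt_id (0 : 𝕜)).mul_const v.2).const_add z.2
  exact ((h1.const_mul (c i 0)).add (h2.const_mul (c i 1))).add_const (c i 2)

theorem hasDerivAt_jacNum (c : Matrix (Fin 3) (Fin 3) 𝕜) (i j : Fin 3) (z v : 𝕜 × 𝕜) :
    HasDerivAt (fun t : 𝕜 => jacNum c i j (z + t • v))
      ((c 2 0 * v.1 + c 2 1 * v.2) * c i j - (c i 0 * v.1 + c i 1 * v.2) * c 2 j) 0 :=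
  ((hasDerivAt_linForm c 2 z v).mul_const _).sub ((hasDerivAt_linForm c i z v).mul_const _)

theorem fderiv_chartMap (h : linForm c 2 z ≠ 0) (v : 𝕜 × 𝕜) :
    fderiv 𝕜 (chartMap c) z v = (1 / linForm c 2 z ^ 2) •
      (jacNum c 0 0 z * v.1 + jacNum c 0 1 z * v.2,
        jacNum c 1 0 z * v.1 + jacNum c 1 1 z * v.2) := by
  have hd : ∀ i, DifferentiableAt 𝕜 (fun w => linForm c i w / linForm c 2 w) z := fun i =>
    ((contDiff_linForm i).contDiffAt.div (contDiff_linForm 2).contDiffAt h).differentiableAt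
      (by simp)
  have e : ∀ i, fderiv 𝕜 (fun w => linForm c i w / linForm c 2 w) z v =
      (1 / linForm c 2 z ^ 2) * (jacNum c i 0 z * v.1 + jacNum c i 1 z * v.2) := fun i => by
    apply fderiv_eq_of_line (hd i)
    refine ((hasDerivAt_linForm c i z v).div (hasDerivAt_linForm c 2 z v)
      (by simpa using h)).congr_deriv ?_
    simp only [zero_smul, add_zero, jacNum]
    field_simp
    ring
  have h' : HasFDerivAt (chartMap c) _ z := (hd 0).hasFDerivAt.prodMk (hd 1).hasFDerivAt
  rw [h'.fderiv]
  simp [e]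

theorem jacNum_mul_sub (c : Matrix (Fin 3) (Fin 3) 𝕜) (z : 𝕜 × 𝕜) :
    jacNum c 0 0 z * jacNum c 1 1 z - jacNum c 0 1 z * jacNum c 1 0 z =
      linForm c 2 z * c.det := by
  simp only [jacNum, linForm, Matrix.det_fin_three]
  ring

theorem minor_mul_jacNum_sub (c : Matrix (Fin 3) (Fin 3) 𝕜) (z : 𝕜 × 𝕜) :
    (c 2 1 * c 0 0 - c 0 1 * c 2 0) * jacNum c 1 1 z -
      (c 2 1 * c 1 0 - c 1 1 * c 2 0) * jacNum c 0 1 z = c.det * c 2 1 := by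
  simp only [jacNum, linForm, Matrix.det_fin_three]
  ring

variable {m : Fin 3 → 𝕜 × 𝕜 → 𝕜} {U : Set (𝕜 × 𝕜)}

theorem fderiv_chartMap_dir (hz : z ∈ pullDomain c m U) (i : Fin 3) :
    fderiv 𝕜 (chartMap c) z (1, pullSlope c m i z) =
      (c.det / (linForm c 2 z * slopeDen c (m i (chartMap c z)) z)) •
        ((1 : 𝕜), m i (chartMap c z)) := by
  obtain ⟨h, -, hs⟩ := hz
  have hs := hs i
  rw [fderiv_chartMap h]
  have e := jacNum_mul_sub c z
  have hsl : slopeDen c (m i (chartMap c z)) z = jacNum c 1 1 z -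
    m i (chartMap c z) * jacNum c 0 1 z := rfl
  simp only [pullSlope]
  generalize slopeDen c (m i (chartMap c z)) z = Λ at *
  generalize m i (chartMap c z) = k at *
  ext
  · simp
    field_simp
    rw [hsl]
    linear_combination e
  · simp
    field_simp
    rw [hsl]
    linear_combination k * e

namespace LinearSlopes

theorem isOpen_pullDomain (hm : LinearSlopes m U) : IsOpen (pullDomain c m U) := by
  rw [isOpen_iff_mem_nhds]
  rintro z ⟨h1, h2, h3⟩
  have hc : ContinuousAt (chartMap c) z := (contDiffAt_chartMap h1).continuousAt
  have e1 := (contDiff_linForm (c := c) 2).continuous.continuousAt.eventually_ne h1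
  have e2 := hc.eventually_mem (hm.isOpen.mem_nhds h2)
  have e3 : ∀ i, ∀ᶠ w in 𝓝 z, slopeDen c (m i (chartMap c w)) w ≠ 0 := fun i => by
    refine ContinuousAt.eventually_ne ?_ (h3 i)
    have hj := fun i j => (contDiff_jacNum (c := c) i j).continuous.continuousAt (x := z)
    exact (hj 1 1).sub ((ContinuousAt.comp (f := chartMap c)
      (hm.contDiffAt h2 i).continuousAt hc).mul (hj 0 1))
  filter_upwards [e1, e2, eventually_all.2 e3] with w a b d using ⟨a, b, d⟩

theorem contDiffAt_pullSlope (hm : LinearSlopes m U) (hz : z ∈ pullDomain c m U) (i : Fin 3) :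
    ContDiffAt 𝕜 ∞ (pullSlope c m i) z := by
  obtain ⟨h1, h2, h3⟩ := hz
  have hj := fun i j => (contDiff_jacNum (c := c) i j).contDiffAt (x := z)
  have hk : ContDiffAt 𝕜 ∞ (fun w => m i (chartMap c w)) z :=
    ContDiffAt.comp (f := chartMap c) z (hm.contDiffAt h2 i) (contDiffAt_chartMap h1)
  exact ((hk.mul (hj 0 0)).sub (hj 1 0)).div ((hj 1 1).sub (hk.mul (hj 0 1))) (h3 i)

theorem fderiv_comp_chartMap {f : 𝕜 × 𝕜 → 𝕜} (hf : DifferentiableAt 𝕜 f (chartMap c z))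
    (h : linForm c 2 z ≠ 0) (v : 𝕜 × 𝕜) :
    fderiv 𝕜 (fun w => f (chartMap c w)) z v =
      fderiv 𝕜 f (chartMap c z) (fderiv 𝕜 (chartMap c) z v) := by
  have := fderiv_comp z hf ((contDiffAt_chartMap h).differentiableAt (by simp))
  exact congrArg (fun l => l v) this

theorem hasDerivAt_comp_chartMap {f : 𝕜 × 𝕜 → 𝕜} (hf : DifferentiableAt 𝕜 f (chartMap c z))
    (h : linForm c 2 z ≠ 0) (v : 𝕜 × 𝕜) :
    HasDerivAt (fun t : 𝕜 => f (chartMap c (z + t • v)))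
      (fderiv 𝕜 f (chartMap c z) (fderiv 𝕜 (chartMap c) z v)) 0 :=
  hasDerivAt_line (f := fun w => f (chartMap c w))
    (hf.comp z ((contDiffAt_chartMap h).differentiableAt (by simp))) v
    (fderiv_comp_chartMap hf h v)

theorem dY_pullSlope (hm : LinearSlopes m U) (hz : z ∈ pullDomain c m U) (i : Fin 3) :
    dY (pullSlope c m i) z =
      (dY (m i) (chartMap c z) * c.det / linForm c 2 z +
        (m i (chartMap c z) * (c 2 1 * c 0 0 - c 0 1 * c 2 0) -
          (c 2 1 * c 1 0 - c 1 1 * c 2 0))) / slopeDen c (m i (chartMap c z)) z := by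
  have hd := (hm.contDiffAt_pullSlope hz i).differentiableAt (by simp)
  obtain ⟨h1, h2, h3⟩ := hz
  have h3 := h3 i
  have hk := hasDerivAt_comp_chartMap (hm.differentiableAt h2 i) h1 ((0 : 𝕜), (1 : 𝕜))
  rw [hm.fderiv_slope h2, fderiv_chartMap h1] at hk
  have hj := fun i j => hasDerivAt_jacNum c i j z ((0 : 𝕜), (1 : 𝕜))
  apply fderiv_eq_of_line hd
  have e := jacNum_mul_sub c z
  have hsl : slopeDen c (m i (chartMap c z)) z = jacNum c 1 1 z -
    m i (chartMap c z) * jacNum c 0 1 z := rfl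
  refine (((hk.mul (hj 0 0)).sub (hj 1 0)).div ((hj 1 1).sub (hk.mul (hj 0 1)))
    (by simpa only [Pi.sub_apply, Pi.mul_apply, zero_smul, add_zero, ← hsl] using h3)).congr_deriv ?_
  simp only [zero_smul, add_zero, Pi.mul_apply, Pi.sub_apply, ← hsl]
  simp
  generalize slopeDen c (m i (chartMap c z)) z = Λ at *
  generalize m i (chartMap c z) = k at *
  generalize dY (m i) (chartMap c z) = k1 at *
  generalize c.det = Δ at *
  generalize linForm c 2 z = N at *
  generalize jacNum c 0 0 z = A0, jacNum c 0 1 z = A1, jacNum c 1 0 z = B0, jacNum c 1 1 z = B1 at *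
  field_simp
  subst hsl
  linear_combination k1 * (B1 - A1 * k) * e

/-- The terms with first derivatives cancel, because projective transformations preserve lines. -/
theorem dY_dY_pullSlope (hm : LinearSlopes m U) (hz : z ∈ pullDomain c m U) (i : Fin 3) :
    dY (dY (pullSlope c m i)) z =
      dY (dY (m i)) (chartMap c z) * c.det / linForm c 2 z ^ 3 := by
  have hd := (hm.contDiffAt_pullSlope hz i).dY.differentiableAt (by simp)
  have hev : dY (pullSlope c m i) =ᶠ[𝓝 z] fun w =>
      (dY (m i) (chartMap c w) * c.det / linForm c 2 w +
        (m i (chartMap c w) * (c 2 1 * c 0 0 - c 0 1 * c 2 0) -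
          (c 2 1 * c 1 0 - c 1 1 * c 2 0))) / slopeDen c (m i (chartMap c w)) w := by
    filter_upwards [hm.isOpen_pullDomain.mem_nhds hz] with w hw using hm.dY_pullSlope hw i
  obtain ⟨h1, h2, h3⟩ := hz
  have h3 := h3 i
  have hk := hasDerivAt_comp_chartMap (hm.differentiableAt h2 i) h1 ((0 : 𝕜), (1 : 𝕜))
  rw [hm.fderiv_slope h2, fderiv_chartMap h1] at hk
  have hk1 := hasDerivAt_comp_chartMap (hm.differentiableAt_dY h2 i) h1 ((0 : 𝕜), (1 : 𝕜))
  rw [hm.fderiv_dY h2, fderiv_chartMap h1] at hk1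
  have hj := fun i j => hasDerivAt_jacNum c i j z ((0 : 𝕜), (1 : 𝕜))
  have hN := hasDerivAt_linForm c 2 z ((0 : 𝕜), (1 : 𝕜))
  have e := jacNum_mul_sub c z
  have e2 := minor_mul_jacNum_sub c z
  have hsl : slopeDen c (m i (chartMap c z)) z = jacNum c 1 1 z -
    m i (chartMap c z) * jacNum c 0 1 z := rfl
  change fderiv 𝕜 (dY (pullSlope c m i)) z (0, 1) = _
  rw [hev.fderiv_eq]
  apply fderiv_eq_of_line (hev.differentiableAt_iff.1 hd)
  refine ((((hk1.mul_const c.det).div hN (by simpa only [zero_smul, add_zero] using h1)).add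
    ((hk.mul_const (c 2 1 * c 0 0 - c 0 1 * c 2 0)).sub_const
      (c 2 1 * c 1 0 - c 1 1 * c 2 0))).div ((hj 1 1).sub (hk.mul (hj 0 1)))
    (by simpa only [Pi.sub_apply, Pi.mul_apply, zero_smul, add_zero, ← hsl] using h3)).congr_deriv ?_
  simp only [zero_smul, add_zero, Pi.mul_apply, Pi.sub_apply, Pi.add_apply, Pi.div_apply, ← hsl]
  simp
  generalize slopeDen c (m i (chartMap c z)) z = Λ at *
  generalize m i (chartMap c z) = k at *
  generalize dY (dY (m i)) (chartMap c z) = k2 at *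
  generalize dY (m i) (chartMap c z) = k1 at *
  generalize c.det = Δ at *
  generalize linForm c 2 z = N at *
  generalize jacNum c 0 0 z = A0, jacNum c 0 1 z = A1, jacNum c 1 0 z = B0, jacNum c 1 1 z = B1 at *
  field_simp
  subst hsl
  linear_combination k1 * N * (B1 - A1 * k) * e2

/-- Differences of slopes acquire a common factor and one factor for each of the two slopes; this
makes `den`, `inv` and `frame`, which are built from them, transform simply. -/
theorem pullSlope_sub (hz : z ∈ pullDomain c m U) (i j : Fin 3) :
    pullSlope c m i z - pullSlope c m j z =
      (m i (chartMap c z) - m j (chartMap c z)) * (linForm c 2 z * c.det) /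
        (slopeDen c (m i (chartMap c z)) z * slopeDen c (m j (chartMap c z)) z) := by
  obtain ⟨h1, h2, h3⟩ := hz
  have hi := h3 i
  have hj := h3 j
  have e := jacNum_mul_sub c z
  simp only [pullSlope]
  field_simp
  rw [mul_assoc, ← e]
  simp only [slopeDen]
  ring

theorem den_pullSlope (hm : LinearSlopes m U) (hz : z ∈ pullDomain c m U) (i : Fin 3) :
    den (pullSlope c m) z = den m (chartMap c z) * c.det ^ 2 /
      (slopeDen c (m i (chartMap c z)) z * slopeDen c (m (i + 1) (chartMap c z)) z *
        slopeDen c (m (i + 2) (chartMap c z)) z) := by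
  rw [den_eq _ i, den_eq _ i]
  simp only [hm.dY_pullSlope hz, pullSlope_sub hz]
  obtain ⟨h1, h2, h3⟩ := hz
  have hi := h3 i
  have hj := h3 (i + 1)
  have hk := h3 (i + 2)
  generalize slopeDen c (m i (chartMap c z)) z = Λ at *
  generalize slopeDen c (m (i + 1) (chartMap c z)) z = Λ1 at *
  generalize slopeDen c (m (i + 2) (chartMap c z)) z = Λ2 at *
  generalize c.det = Δ at *
  field_simp
  ring

theorem inv_pullSlope (hm : LinearSlopes m U) (hz : z ∈ pullDomain c m U)
    (hc : c.det ≠ 0) (i : Fin 3) :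
    inv (pullSlope c m) i z = inv m i (chartMap c z) := by
  rw [inv_eq_weight_mul, inv_eq_weight_mul, weight_eq _ i, weight_eq _ i]
  simp only [hm.dY_dY_pullSlope hz, pullSlope_sub hz, hm.den_pullSlope hz i]
  obtain ⟨h1, h2, h3⟩ := hz
  have hi := h3 i
  have hj := h3 (i + 1)
  have hk := h3 (i + 2)
  generalize slopeDen c (m i (chartMap c z)) z = Λ at *
  generalize slopeDen c (m (i + 1) (chartMap c z)) z = Λ1 at *
  generalize slopeDen c (m (i + 2) (chartMap c z)) z = Λ2 at *
  generalize c.det = Δ at *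
  -- if `den` vanishes, both sides are zero, by the convention for division by zero
  by_cases hD : den m (chartMap c z) = 0
  · simp [hD]
  · field_simp

theorem fderiv_chartMap_frame (hm : LinearSlopes m U) (hz : z ∈ pullDomain c m U)
    (hc : c.det ≠ 0) (i : Fin 3) :
    fderiv 𝕜 (chartMap c) z (frame (pullSlope c m) i z) = frame m i (chartMap c z) := by
  rw [frame, map_smul, fderiv_chartMap_dir hz, smul_smul, frame, pullSlope_sub hz,
    hm.den_pullSlope hz i]
  congr 1
  obtain ⟨h1, h2, h3⟩ := hz
  have hi := h3 i
  have hj := h3 (i + 1)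
  have hk := h3 (i + 2)
  generalize slopeDen c (m i (chartMap c z)) z = Λ at *
  generalize slopeDen c (m (i + 1) (chartMap c z)) z = Λ1 at *
  generalize slopeDen c (m (i + 2) (chartMap c z)) z = Λ2 at *
  generalize c.det = Δ at *
  -- if `den` vanishes, both sides are zero, by the convention for division by zero
  by_cases hD : den m (chartMap c z) = 0
  · simp [hD]
  · field_simp

theorem del_pullSlope (hm : LinearSlopes m U) (hz : z ∈ pullDomain c m U)
    (hc : c.det ≠ 0) (i : Fin 3) {f g : 𝕜 × 𝕜 → 𝕜} (hf : DifferentiableAt 𝕜 f (chartMap c z))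
    (hg : ∀ᶠ w in 𝓝 z, g w = f (chartMap c w)) :
    del (pullSlope c m) i g z = del m i f (chartMap c z) := by
  simp only [del_eq]
  rw [EventuallyEq.fderiv_eq hg, fderiv_comp_chartMap hf hz.1, hm.fderiv_chartMap_frame hz hc]

/-- The signature is projectively invariant. -/
theorem signature_pullSlope (hm : LinearSlopes m U) (hz : z ∈ pullDomain c m U)
    (hc : c.det ≠ 0) (hd : den m (chartMap c z) ≠ 0) :
    signature (pullSlope c m) z = signature m (chartMap c z) := by
  have hev : ∀ᶠ w in 𝓝 z, w ∈ pullDomain c m U ∧ den m (chartMap c w) ≠ 0 :=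
    (hm.isOpen_pullDomain.eventually_mem hz).and
      ((ContinuousAt.comp (f := chartMap c) (hm.contDiffAt_den hz.2.1).continuousAt
        (contDiffAt_chartMap hz.1).continuousAt).eventually_ne hd)
  have h0 : ∀ w ∈ pullDomain c m U, ∀ j, inv (pullSlope c m) j w = inv m j (chartMap c w) :=
    fun w hw j => hm.inv_pullSlope hw hc j
  have c0 : ∀ w ∈ pullDomain c m U, den m (chartMap c w) ≠ 0 → ∀ j,
      ContDiffAt 𝕜 ∞ (inv m j) (chartMap c w) := fun w hw hd j => hm.contDiffAt_inv hw.2.1 hd j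
  have h1 : ∀ w ∈ pullDomain c m U, den m (chartMap c w) ≠ 0 → ∀ j,
      del (pullSlope c m) (j + 1) (inv (pullSlope c m) j) w =
        del m (j + 1) (inv m j) (chartMap c w) := fun w hw hd j =>
    hm.del_pullSlope hw hc _ ((c0 w hw hd j).differentiableAt (by simp))
      ((hm.isOpen_pullDomain.eventually_mem hw).mono fun w hw => h0 w hw j)
  refine signature_eq_iff.2 ⟨h0 z hz, h1 z hz hd, fun j => ?_⟩
  exact hm.del_pullSlope hz hc _
    ((hm.contDiffAt_del hz.2.1 hd _ (c0 z hz hd j)).differentiableAt (by simp))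
    (hev.mono fun w hw => h1 w hw.1 hw.2 j)

theorem fderiv_signature_pullSlope (hm : LinearSlopes m U) (hz : z ∈ pullDomain c m U)
    (hc : c.det ≠ 0) (hd : den m (chartMap c z) ≠ 0) (i : Fin 3) :
    fderiv 𝕜 (signature (pullSlope c m)) z (frame (pullSlope c m) i z) =
      fderiv 𝕜 (signature m) (chartMap c z) (frame m i (chartMap c z)) := by
  have hev : signature (pullSlope c m) =ᶠ[𝓝 z] fun w => signature m (chartMap c w) := by
    filter_upwards [hm.isOpen_pullDomain.eventually_mem hz,
      (ContinuousAt.comp (f := chartMap c) (hm.contDiffAt_den hz.2.1).continuousAt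
        (contDiffAt_chartMap hz.1).continuousAt).eventually_ne hd] with w hw hdw
    exact hm.signature_pullSlope hw hc hdw
  have h := fderiv_comp z ((hm.contDiffAt_signature hz.2.1 hd).differentiableAt (by simp))
    ((contDiffAt_chartMap hz.1).differentiableAt (by simp))
  rw [hev.fderiv_eq, ← hm.fderiv_chartMap_frame hz hc i]
  exact congrArg (fun l => l (frame (pullSlope c m) i z)) h

end LinearSlopes

end ChartMap

/-! ### Affine charts and linear webs -/

theorem trans_ne_zero (g : Trans 𝕜) {v : Fin 3 → 𝕜} (hv : v ≠ 0) : g v ≠ 0 := by simpa using hv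

theorem affineChart_eq_mk (g : Trans 𝕜) (z : 𝕜 × 𝕜) :
    affineChart g z =
      Projectivization.mk 𝕜 (g (affineVec z)) (trans_ne_zero g (affineVec_ne_zero z)) := rfl

theorem smul_affineChart (G g : Trans 𝕜) (z : 𝕜 × 𝕜) :
    G • affineChart g z = affineChart (g.trans G) z := rfl

theorem continuous_trans (g : Trans 𝕜) : Continuous g :=
  LinearMap.continuous_of_finiteDimensional (g : (Fin 3 → 𝕜) →ₗ[𝕜] (Fin 3 → 𝕜))

theorem continuous_affineVec : Continuous (affineVec : 𝕜 × 𝕜 → Fin 3 → 𝕜) := by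
  refine continuous_pi fun i => ?_
  fin_cases i
  · exact continuous_fst
  · exact continuous_snd
  · exact continuous_const

theorem IsOpenSet.isOpen_preimage_affineChart {N : Set (Plane 𝕜)} (hN : IsOpenSet N)
    (g : Trans 𝕜) : IsOpen {z | affineChart g z ∈ N} := by
  have h : IsOpen ((fun z => g (affineVec z)) ⁻¹'
      {v : Fin 3 → 𝕜 | ∃ h : v ≠ 0, Projectivization.mk 𝕜 v h ∈ N}) :=
    hN.preimage ((continuous_trans g).comp continuous_affineVec)
  convert h using 1
  ext z
  rw [Set.mem_preimage]
  exact ⟨fun hz => ⟨trans_ne_zero g (affineVec_ne_zero z), hz⟩, fun ⟨_, hz⟩ => hz⟩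

theorem isOpenSet_image_affineChart (g : Trans 𝕜) {O : Set (𝕜 × 𝕜)} (hO : IsOpen O) :
    IsOpenSet {q : Plane 𝕜 | ∃ w ∈ O, affineChart g w = q} := by
  have hc : Continuous g.symm := continuous_trans g.symm
  have hci : ∀ i, Continuous fun v => g.symm v i := fun i => (continuous_apply i).comp hc
  have hcont : ContinuousOn (fun v => ((g.symm v 0 / g.symm v 2, g.symm v 1 / g.symm v 2) : 𝕜 × 𝕜))
      {v | g.symm v 2 ≠ 0} :=
    ((hci 0).continuousOn.div (hci 2).continuousOn fun _ h => h).prodMk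
      ((hci 1).continuousOn.div (hci 2).continuousOn fun _ h => h)
  have := hcont.isOpen_inter_preimage (isOpen_ne.preimage (hci 2)) hO
  unfold IsOpenSet
  convert this using 1
  ext v
  constructor
  · rintro ⟨hv, w, hw, e⟩
    rw [affineChart_eq_mk, Projectivization.mk_eq_mk_iff'] at e
    obtain ⟨a, ha⟩ := e
    have ha0 : a ≠ 0 := by
      rintro rfl
      rw [zero_smul] at ha
      exact trans_ne_zero g (affineVec_ne_zero w) ha.symm
    have hs : g.symm v = a⁻¹ • affineVec w := by
      rw [← g.symm_apply_apply (affineVec w), ← ha, map_smul, smul_smul, inv_mul_cancel₀ ha0,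
        one_smul]
    refine ⟨?_, ?_⟩
    · simp [hs, affineVec, ha0]
    · simp only [Set.mem_preimage, hs]
      convert hw using 1
      ext <;> simp [affineVec] <;> field_simp
  · rintro ⟨h2, hw⟩
    have h2 : g.symm v 2 ≠ 0 := h2
    have hv : v ≠ 0 := by
      rintro rfl
      simp at h2
    refine ⟨hv, _, hw, ?_⟩
    rw [affineChart_eq_mk, Projectivization.mk_eq_mk_iff']
    refine ⟨(g.symm v 2)⁻¹, ?_⟩
    apply g.symm.injective
    rw [map_smul, g.symm_apply_apply]
    ext i
    fin_cases i
    · simp [affineVec]; field_simp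
    · simp [affineVec]; field_simp
    · simp [affineVec, h2]

theorem eq_of_slopeLine_eq {z w : 𝕜 × 𝕜} {k l : 𝕜} (h : slopeLine w k = slopeLine z l) : k = l := by
  have : ![1, k, 0] ∈ slopeLine z l := by
    rw [← h]
    exact Submodule.subset_span (by simp)
  obtain ⟨a, b, e⟩ := Submodule.mem_span_pair.1 this
  have e0 := congrFun e 0
  have e1 := congrFun e 1
  have e2 := congrFun e 2
  simp [affineVec] at e0 e1 e2
  rw [e2] at e0 e1
  simp at e0 e1
  rw [← e1, e0, one_mul]

theorem IsSlopeChart.linearSlopes {L : LinearWeb 𝕜} {g : Trans 𝕜} {U : Set (𝕜 × 𝕜)}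
    {m : Fin 3 → 𝕜 × 𝕜 → 𝕜} (h : IsSlopeChart L.carrier L.line g U m) : LinearSlopes m U where
  isOpen := h.isOpen
  smooth := h.smooth
  ne z hz i j hij e := by
    apply L.distinct _ (h.mem z hz) i j hij
    rw [h.line_eq z hz, h.line_eq z hz, e]
  leaf z hz i := by
    obtain ⟨N, hN, hpN, -, hleaf⟩ := L.leaf _ (h.mem z hz)
    have hd : DifferentiableAt 𝕜 (m i) z :=
      ((h.smooth i).contDiffAt (h.isOpen.mem_nhds hz)).differentiableAt (by simp)
    have hc : Tendsto (fun t : 𝕜 => z + t • ((1 : 𝕜), m i z)) (𝓝 0) (𝓝 z) := by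
      have : Continuous fun t : 𝕜 => z + t • ((1 : 𝕜), m i z) := by fun_prop
      simpa using this.tendsto 0
    have hev : (fun t : 𝕜 => m i (z + t • ((1 : 𝕜), m i z))) =ᶠ[𝓝 0] fun _ => m i z := by
      filter_upwards [hc.eventually_mem (h.isOpen.mem_nhds hz),
        hc.eventually_mem ((hN.isOpen_preimage_affineChart g).mem_nhds hpN)] with t ht1 ht2
      have hl := hleaf _ ht2 i ?_
      · rw [h.line_eq _ ht1, h.line_eq _ hz] at hl
        exact eq_of_slopeLine_eq (Submodule.map_injective_of_injective g.injective hl)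
      · rw [h.line_eq _ hz, affineChart_eq_mk, Projectivization.submodule_mk,
          Submodule.span_singleton_le_iff_mem]
        refine Submodule.mem_map_of_mem (Submodule.mem_span_pair.2 ⟨1, t, ?_⟩)
        ext j
        fin_cases j <;> simp [affineVec]
    exact fderiv_eq_of_line hd ((hasDerivAt_const (0 : 𝕜) (m i z)).congr_of_eventuallyEq hev)

section ChartChange

variable {c : Matrix (Fin 3) (Fin 3) 𝕜} {z : 𝕜 × 𝕜}

theorem mulVec_affineVec (h : linForm c 2 z ≠ 0) :
    c.mulVec (affineVec z) = linForm c 2 z • affineVec (chartMap c z) := by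
  ext i
  have : c.mulVec (affineVec z) i = linForm c i z := by
    simp [Matrix.mulVec, dotProduct, Fin.sum_univ_three, affineVec, linForm]
  rw [this]
  fin_cases i
  · simp [affineVec, chartMap]; field_simp
  · simp [affineVec, chartMap]; field_simp
  · simp [affineVec]

theorem mulVec_dir {m : Fin 3 → 𝕜 × 𝕜 → 𝕜} {U : Set (𝕜 × 𝕜)} (hz : z ∈ pullDomain c m U)
    (i : Fin 3) :
    c.mulVec ![1, pullSlope c m i z, 0] =
      (c 2 0 + c 2 1 * pullSlope c m i z) • affineVec (chartMap c z) +
      (c.det / slopeDen c (m i (chartMap c z)) z) • ![1, m i (chartMap c z), 0] := by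
  have e := jacNum_mul_sub c z
  obtain ⟨h1, -, h3⟩ := hz
  have h3 := h3 i
  have hsl : slopeDen c (m i (chartMap c z)) z = jacNum c 1 1 z -
    m i (chartMap c z) * jacNum c 0 1 z := rfl
  have hps : pullSlope c m i z = (m i (chartMap c z) * jacNum c 0 0 z - jacNum c 1 0 z) /
    slopeDen c (m i (chartMap c z)) z := rfl
  rw [eq_div_iff h3] at hps
  generalize pullSlope c m i z = k'' at *
  have ha : ∀ i j, linForm c 2 z * c i j = jacNum c i j z + linForm c i z * c 2 j := fun i j => by
    simp [jacNum]
  have a00 := ha 0 0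
  have a01 := ha 0 1
  have a10 := ha 1 0
  have a11 := ha 1 1
  simp only [chartMap, affineVec]
  rw [← chartMap]
  generalize slopeDen c (m i (chartMap c z)) z = Λ at *
  generalize m i (chartMap c z) = k at *
  ext j
  fin_cases j
  · simp [Matrix.mulVec, dotProduct, Fin.sum_univ_three]
    field_simp
    linear_combination Λ * a00 + Λ * k'' * a01 + e + jacNum c 0 1 z * hps +
      jacNum c 0 0 z * hsl
  · simp [Matrix.mulVec, dotProduct, Fin.sum_univ_three]
    field_simp
    linear_combination Λ * a10 + Λ * k'' * a11 + k * e + jacNum c 1 1 z * hps +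
      jacNum c 1 0 z * hsl
  · simp [Matrix.mulVec, dotProduct, Fin.sum_univ_three]

end ChartChange

/-! ### Projective frames of focal points -/

theorem toMatrix'_mulVec (h : Trans 𝕜) (v : Fin 3 → 𝕜) :
    (LinearMap.toMatrix' (h : (Fin 3 → 𝕜) →ₗ[𝕜] (Fin 3 → 𝕜))).mulVec v = h v :=
  LinearMap.toMatrix'_mulVec _ _

theorem det_toMatrix'_ne_zero (h : Trans 𝕜) :
    (LinearMap.toMatrix' (h : (Fin 3 → 𝕜) →ₗ[𝕜] (Fin 3 → 𝕜))).det ≠ 0 := by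
  rw [LinearMap.det_toMatrix']
  exact (LinearEquiv.isUnit_det' h).ne_zero

theorem span_pair_smul_eq {V : Type*} [AddCommGroup V] [Module 𝕜 V] {a b : V} {α β γ : 𝕜}
    (hα : α ≠ 0) (hγ : γ ≠ 0) :
    Submodule.span 𝕜 {α • a, β • a + γ • b} = Submodule.span 𝕜 {a, b} := by
  apply le_antisymm
  · rw [Submodule.span_le, Set.insert_subset_iff, Set.singleton_subset_iff]
    exact ⟨Submodule.mem_span_pair.2 ⟨α, 0, by simp⟩, Submodule.mem_span_pair.2 ⟨β, γ, rfl⟩⟩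
  · rw [Submodule.span_le, Set.insert_subset_iff, Set.singleton_subset_iff]
    refine ⟨Submodule.mem_span_pair.2 ⟨α⁻¹, 0, by simp [smul_smul, hα]⟩,
      Submodule.mem_span_pair.2 ⟨-(γ⁻¹ * β * α⁻¹), γ⁻¹, ?_⟩⟩
    rw [smul_add, smul_smul, smul_smul, smul_smul, inv_mul_cancel₀ hγ, one_smul, ← add_assoc,
      ← add_smul]
    have : -(γ⁻¹ * β * α⁻¹) * α + γ⁻¹ * β = 0 := by field_simp; ring
    rw [this, zero_smul, zero_add]

/-- A slope chart composed with a projective transformation is a slope chart. -/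
theorem IsSlopeChart.pullSlope {L : LinearWeb 𝕜} {g : Trans 𝕜} {U : Set (𝕜 × 𝕜)}
    {m : Fin 3 → 𝕜 × 𝕜 → 𝕜} (hm : IsSlopeChart L.carrier L.line g U m) (h : Trans 𝕜)
    {c : Matrix (Fin 3) (Fin 3) 𝕜} (hc : ∀ v, c.mulVec v = h v) (hdet : c.det ≠ 0) :
    IsSlopeChart L.carrier L.line (h.trans g) (pullDomain c m U) (pullSlope c m) := by
  have hch : ∀ z ∈ pullDomain c m U, affineChart (h.trans g) z = affineChart g (chartMap c z) := by
    intro z hz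
    rw [affineChart_eq_mk, affineChart_eq_mk, Projectivization.mk_eq_mk_iff']
    refine ⟨linForm c 2 z, ?_⟩
    rw [LinearEquiv.trans_apply, ← hc, mulVec_affineVec hz.1, map_smul]
  refine ⟨hm.linearSlopes.isOpen_pullDomain, fun i z hz =>
    (hm.linearSlopes.contDiffAt_pullSlope hz i).contDiffWithinAt, fun z hz => ?_, fun z hz i => ?_⟩
  · rw [hch z hz]
    exact hm.mem _ hz.2.1
  · rw [hch z hz, hm.line_eq _ hz.2.1, LinearEquiv.coe_trans, Submodule.map_comp]
    congr 1
    rw [slopeLine, slopeLine, Submodule.map_span, Set.image_pair]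
    change _ = Submodule.span 𝕜 {h (affineVec z), h ![1, PlanarWeb.pullSlope c m i z, 0]}
    rw [← hc, ← hc, mulVec_affineVec hz.1, mulVec_dir hz, span_pair_smul_eq hz.1]
    exact div_ne_zero hdet (hz.2.2 i)

namespace LinearSlopes

variable {m m' : Fin 3 → 𝕜 × 𝕜 → 𝕜} {U U' : Set (𝕜 × 𝕜)} {z z' : 𝕜 × 𝕜}

/-- The coefficient of the `i`-th focal vector in the expansion of `affineVec z`. -/
def focalCoeff (m : Fin 3 → 𝕜 × 𝕜 → 𝕜) (i : Fin 3) (z : 𝕜 × 𝕜) : 𝕜 :=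
  (m (i + 2) z - m (i + 1) z) / den m z

theorem focalCoeff_ne_zero (hm : LinearSlopes m U) (hz : z ∈ U) (hd : den m z ≠ 0) (i : Fin 3) :
    focalCoeff m i z ≠ 0 :=
  div_ne_zero (sub_ne_zero.2 (hm.ne z hz _ _ (by fin_cases i <;> decide))) hd

theorem sum_focalCoeff_smul (hd : den m z ≠ 0) :
    ∑ i, focalCoeff m i z • focalVec m i z = affineVec z := by
  have e : den m z = dY (m 0) z * (m 2 z - m 1 z) + dY (m 1) z * (m 0 z - m 2 z) +
    dY (m 2) z * (m 1 z - m 0 z) := congrFun (den_eq m 0) z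
  have a1 : focalCoeff m 0 z = (m 2 z - m 1 z) / den m z := rfl
  have a2 : focalCoeff m 1 z = (m 0 z - m 2 z) / den m z := rfl
  have a3 : focalCoeff m 2 z = (m 1 z - m 0 z) / den m z := rfl
  rw [Fin.sum_univ_three, a1, a2, a3]
  ext i
  fin_cases i
  · simp [focalVec, affineVec]
    field_simp
    linear_combination -z.1 * e
  · simp [focalVec, affineVec]
    field_simp
    linear_combination -z.2 * e
  · simp [focalVec, affineVec]
    field_simp
    linear_combination - e

/-- There is a projective transformation that maps a point to a given one and the three focal
points to the respective focal points of another web: these are projective frames. -/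
theorem exists_trans_focalVec (hm : LinearSlopes m U) (hz : z ∈ U) (hn : NonRegularAt m z)
    (hm' : LinearSlopes m' U') (hz' : z' ∈ U') (hn' : NonRegularAt m' z') :
    ∃ h : Trans 𝕜, h (affineVec z) = affineVec z' ∧
      ∃ μ : Fin 3 → 𝕜, ∀ i, h (focalVec m i z) = μ i • focalVec m' i z' := by
  have hd := (nonRegularAt_iff m z).1 hn
  have hd' := (nonRegularAt_iff m' z').1 hn'
  have h0 := hm.focalCoeff_ne_zero hz hd
  have h0' := hm'.focalCoeff_ne_zero hz' hd'
  let b := basisOfLinearIndependentOfCardEqFinrank hn (by simp)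
  let b' := basisOfLinearIndependentOfCardEqFinrank
    (hn'.units_smul fun i => Units.mk0 (focalCoeff m' i z' / focalCoeff m i z)
      (div_ne_zero (h0' i) (h0 i))) (by simp)
  have hb : ∀ i, b.equiv b' (Equiv.refl _) (focalVec m i z) =
      (focalCoeff m' i z' / focalCoeff m i z) • focalVec m' i z' := by
    intro i
    have e : b i = focalVec m i z :=
      congrFun (coe_basisOfLinearIndependentOfCardEqFinrank hn (by simp)) i
    rw [← e, Module.Basis.equiv_apply]
    exact congrFun (coe_basisOfLinearIndependentOfCardEqFinrank _ _) i
  refine ⟨b.equiv b' (Equiv.refl _), ?_, fun i => focalCoeff m' i z' / focalCoeff m i z, hb⟩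
  rw [← sum_focalCoeff_smul hd, ← sum_focalCoeff_smul hd', map_sum]
  refine Finset.sum_congr rfl fun i _ => ?_
  rw [map_smul, hb, smul_smul, mul_div_cancel₀ _ (h0 i)]

/-- A transformation of projective frames as in `exists_trans_focalVec` pulls the slopes back to
slopes with the same 1-jet. -/
theorem pullSlope_jet (hm' : LinearSlopes m' U') (hz' : z' ∈ U')
    {c : Matrix (Fin 3) (Fin 3) 𝕜} (hc : c.det ≠ 0) (hv : c.mulVec (affineVec z) = affineVec z')
    {μ : Fin 3 → 𝕜} (hF : ∀ i, c.mulVec (focalVec m i z) = μ i • focalVec m' i z') :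
    z ∈ pullDomain c m' U' ∧ chartMap c z = z' ∧
      ∀ i, pullSlope c m' i z = m i z ∧ dY (pullSlope c m' i) z = dY (m i) z := by
  have hN : ∀ i, linForm c i z = affineVec z' i := fun i => by
    rw [← hv]
    simp [Matrix.mulVec, dotProduct, Fin.sum_univ_three, affineVec, linForm]
  have n0 : linForm c 0 z = z'.1 := hN 0
  have n1 : linForm c 1 z = z'.2 := hN 1
  have n2 : linForm c 2 z = 1 := hN 2
  have hch : chartMap c z = z' := by simp [chartMap, n0, n1, n2]
  have hk : ∀ i, c.mulVec ![1, m i z, 0] = (dY (m i) z - μ i * dY (m' i) z') • affineVec z' +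
      μ i • ![1, m' i z', 0] := fun i => by
    have e : ![1, m i z, 0] = dY (m i) z • affineVec z - focalVec m i z := by simp [focalVec]
    rw [e, Matrix.mulVec_sub, Matrix.mulVec_smul, hv, hF, focalVec]
    module
  have k0 := fun i => congrFun (hk i) 0
  have k1 := fun i => congrFun (hk i) 1
  have k2 := fun i => congrFun (hk i) 2
  simp [Matrix.mulVec, dotProduct, Fin.sum_univ_three, affineVec] at k0 k1 k2
  have hj : ∀ i j, jacNum c i j z = c i j - linForm c i z * c 2 j := fun i j => by
    simp [jacNum, n2]
  have edet := jacNum_mul_sub c z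
  rw [n2, one_mul] at edet
  have hA : ∀ i, jacNum c 0 0 z + m i z * jacNum c 0 1 z = μ i := fun i => by
    rw [hj, hj, n0]
    linear_combination k0 i - z'.1 * k2 i
  have hB : ∀ i, jacNum c 1 0 z + m i z * jacNum c 1 1 z = μ i * m' i z' := fun i => by
    rw [hj, hj, n1]
    linear_combination k1 i - z'.2 * k2 i
  have hΛ : ∀ i, slopeDen c (m' i z') z * μ i = c.det := fun i => by
    rw [slopeDen]
    linear_combination edet - jacNum c 1 1 z * hA i + jacNum c 0 1 z * hB i
  have hΛ0 : ∀ i, slopeDen c (m' i z') z ≠ 0 := fun i h0 => by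
    apply hc
    rw [← hΛ i, h0, zero_mul]
  have hdom : z ∈ pullDomain c m' U' := ⟨by simp [n2], hch ▸ hz', by rw [hch]; exact hΛ0⟩
  have hP : ∀ i, pullSlope c m' i z = m i z := fun i => by
    rw [pullSlope, hch, div_eq_iff (hΛ0 i), slopeDen]
    linear_combination m' i z' * hA i - hB i
  refine ⟨hdom, hch, fun i => ⟨hP i, ?_⟩⟩
  rw [hm'.dY_pullSlope hdom, hch, n2, div_one, div_eq_iff (hΛ0 i)]
  have e1 : m' i z' * (c 2 1 * c 0 0 - c 0 1 * c 2 0) - (c 2 1 * c 1 0 - c 1 1 * c 2 0) =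
      c 2 0 * slopeDen c (m' i z') z +
        c 2 1 * (m' i z' * jacNum c 0 0 z - jacNum c 1 0 z) := by
    simp only [slopeDen, hj]
    ring
  have e2 : m i z * slopeDen c (m' i z') z = m' i z' * jacNum c 0 0 z - jacNum c 1 0 z := by
    rw [slopeDen]
    linear_combination hB i - m' i z' * hA i
  rw [e1, ← e2]
  linear_combination -dY (m' i) z' * hΛ i + slopeDen c (m' i z') z * k2 i

end LinearSlopes

/-- The signature map sends all points near `z` into the signature set. -/
theorem LinearWeb.eventually_signature_mem {L : LinearWeb 𝕜} {g : Trans 𝕜} {U : Set (𝕜 × 𝕜)}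
    {m : Fin 3 → 𝕜 × 𝕜 → 𝕜} {z : 𝕜 × 𝕜} (h : IsSlopeChart L.carrier L.line g U m) (hz : z ∈ U)
    (hd : den m z ≠ 0) {W : Set (Fin 9 → 𝕜)} (hW : IsOpen W) (hzW : signature m z ∈ W) :
    ∀ᶠ w in 𝓝 z, signature m w ∈ L.signatureSet ∩ W := by
  have hm := h.linearSlopes
  filter_upwards [hm.eventually_den_ne hz hd,
    (hm.contDiffAt_signature hz hd).continuousAt.eventually_mem (hW.mem_nhds hzW)] with w hw hwW
  exact ⟨⟨g, U, m, w, h, hw.1, (nonRegularAt_iff m w).2 hw.2, rfl⟩, hwW⟩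

end PlanarWeb

end

/-! ### The equivalence of webs with the same signature set -/

open PlanarWeb Filter Topology in
theorem theorem4 {𝕜 : Type*} [RCLike 𝕜] (L L' : PlanarWeb.LinearWeb 𝕜)
    (p p' : PlanarWeb.Plane 𝕜) (s : Fin 9 → 𝕜)
    (hp : L.IsNonsingularAt p s) (hp' : L'.IsNonsingularAt p' s)
    (hS : ∃ W : Set (Fin 9 → 𝕜), IsOpen W ∧ s ∈ W ∧
      L.signatureSet ∩ W = L'.signatureSet ∩ W) :
    L.GermProjEquiv p L' p' := by
  obtain ⟨g, U, m, z, hch, hz, rfl, hn, hs, -, k, hk, V, f, hV, hsV, hf, hsurj, hfS⟩ := hp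
  obtain ⟨g', U', m', z', hch', hz', rfl, hn', hs', -, k', hk', V', f', hV', hsV', hf', hsurj',
    hfS'⟩ := hp'
  obtain ⟨W, hW, hsW, hSW⟩ := hS
  have hm := hch.linearSlopes
  have hm' := hch'.linearSlopes
  have hd := (nonRegularAt_iff m z).1 hn
  have hd' := (nonRegularAt_iff m' z').1 hn'
  have hff : ContDiffAt 𝕜 ∞ f s := hf.contDiffAt (hV.mem_nhds hsV)
  have hff' : ContDiffAt 𝕜 ∞ f' s := hf'.contDiffAt (hV'.mem_nhds hsV')
  -- near `s`, both defining functions vanish along both signature maps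
  have hmem : ∀ᶠ w in 𝓝 z, signature m w ∈ L.signatureSet ∩ (W ∩ (V ∩ V')) :=
    LinearWeb.eventually_signature_mem hch hz hd (hW.inter (hV.inter hV'))
      (hs.symm ▸ ⟨hsW, hsV, hsV'⟩)
  have hmem' : ∀ᶠ w in 𝓝 z', signature m' w ∈ L'.signatureSet ∩ (W ∩ (V ∩ V')) :=
    LinearWeb.eventually_signature_mem hch' hz' hd' (hW.inter (hV.inter hV'))
      (hs'.symm ▸ ⟨hsW, hsV, hsV'⟩)
  have hz1 : ∀ x ∈ L.signatureSet ∩ (W ∩ (V ∩ V')), f x = 0 ∧ f' x = 0 := fun x hx =>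
    ⟨((Set.ext_iff.1 hfS x).1 ⟨hx.1, hx.2.2.1⟩).2, ((Set.ext_iff.1 hfS' x).1
      ⟨((Set.ext_iff.1 hSW x).1 ⟨hx.1, hx.2.1⟩).1, hx.2.2.2⟩).2⟩
  have hz2 : ∀ x ∈ L'.signatureSet ∩ (W ∩ (V ∩ V')), f x = 0 ∧ f' x = 0 := fun x hx =>
    hz1 x ⟨((Set.ext_iff.1 hSW x).2 ⟨hx.1, hx.2.1⟩).1, hx.2⟩
  have h0 := hmem.mono fun w hw => (hz1 _ hw)
  have h0' := hmem'.mono fun w hw => (hz2 _ hw)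
  obtain ⟨θ, hθ, hθz, hθs⟩ := exists_local_section (hm'.contDiffAt_signature hz' hd')
    (hs'.symm ▸ hff') (hs'.symm ▸ hsurj') hk' (h0'.mono fun w hw => hw.2)
  rw [hs'] at hθ hθz hθs
  have hH := hm.eventually_fderiv_signature_frame_eq hz hd hm' hz' hd' (hs.symm ▸ hff)
    (hs.symm ▸ hsurj) hk (h0.mono fun w hw => hw.1) (h0'.mono fun w hw => hw.1)
    (hs.symm ▸ hθ) (hs.symm ▸ hθz)
    (by
      have := (hm.contDiffAt_signature hz hd).continuousAt.eventually (hs.symm ▸ hθs)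
      filter_upwards [this, h0] with q h1 h2 using h1 h2.2)
  have hH' := hm'.eventually_fderiv_signature_frame_eq hz' hd' hm' hz' hd' (hs'.symm ▸ hff')
    (hs'.symm ▸ hsurj') hk' (h0'.mono fun w hw => hw.2) (h0'.mono fun w hw => hw.2)
    (hs'.symm ▸ hθ) (hs'.symm ▸ hθz)
    (by
      have := (hm'.contDiffAt_signature hz' hd').continuousAt.eventually (hs'.symm ▸ hθs)
      filter_upwards [this, h0'] with q h1 h2 using h1 h2.2)
  -- a projective transformation that makes the 1-jets of the slopes agree
  obtain ⟨h, hv, μ, hμ⟩ := hm.exists_trans_focalVec hz hn hm' hz' hn'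
  obtain ⟨c, hcv, hdet⟩ : ∃ c : Matrix (Fin 3) (Fin 3) 𝕜, (∀ v, c.mulVec v = h v) ∧ c.det ≠ 0 :=
    ⟨_, toMatrix'_mulVec h, det_toMatrix'_ne_zero h⟩
  obtain ⟨hdom, hcz, hjet⟩ := hm'.pullSlope_jet (m := m) hz' hdet ((hcv _).trans hv)
    (fun i => (hcv _).trans (hμ i))
  have hch'' := hch'.pullSlope h hcv hdet
  have hm'' := hch''.linearSlopes
  have hd'' : den (pullSlope c m') z ≠ 0 := by
    rw [hm'.den_pullSlope hdom 0, hcz]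
    have h3 := hdom.2.2
    rw [hcz] at h3
    exact div_ne_zero (mul_ne_zero hd' (pow_ne_zero 2 hdet))
      (mul_ne_zero (mul_ne_zero (h3 _) (h3 _)) (h3 _))
  have hτ : Tendsto (chartMap c) (𝓝 z) (𝓝 z') := by
    have := (contDiffAt_chartMap hdom.1).continuousAt.tendsto
    rwa [hcz] at this
  have heq := hm.eventually_eq_of_jet_eq hz hd hm'' hdom hd''
    (by
      have e : signature (pullSlope c m') z = signature m z := by
        rw [hm'.signature_pullSlope hdom hdet (hcz.symm ▸ hd'), hcz, hs, hs']
      simp [jet, e, (hjet _).1, (hjet _).2])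
    (H := fun i x => fderiv 𝕜 (signature m') (θ x) (frame m' i (θ x)))
    (fun i => by
      rw [hs]
      have e : ContDiffAt 𝕜 ∞ (fun w => fderiv 𝕜 (signature m') w (frame m' i w)) (θ s) := by
        rw [hθz]
        exact ((hm'.contDiffAt_signature hz' hd').fderiv_right (m := ∞) (by simp)).clm_apply
          (hm'.contDiffAt_frame hz' hd' i)
      exact (ContDiffAt.comp (f := θ) s e hθ).of_le (by simp))
    hH
    (by
      filter_upwards [hm''.isOpen.mem_nhds hdom, hτ.eventually hH',
        hτ.eventually (hm'.eventually_den_ne hz' hd')] with q h1 h2 h3 i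
      rw [hm'.fderiv_signature_pullSlope h1 hdet h3.2, hm'.signature_pullSlope h1 hdet h3.2, h2])
  obtain ⟨O, hO, hOo, hzO⟩ := eventually_nhds_iff.1
    (heq.and ((hm.isOpen.eventually_mem hz).and (hm''.isOpen.eventually_mem hdom)))
  have hG : ∀ w, (g.symm.trans h).trans g' • affineChart g w = affineChart (h.trans g') w :=
    fun w => by
      rw [smul_affineChart]
      congr 1
      ext v
      simp
  refine ⟨(g.symm.trans h).trans g', ?_, {q | ∃ w ∈ O, affineChart g w = q},
    isOpenSet_image_affineChart g hOo, ⟨z, hzO, rfl⟩, ?_⟩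
  · rw [hG]
    simp only [affineChart_eq_mk, LinearEquiv.trans_apply, hv]
  · rintro _ ⟨w, hw, rfl⟩
    obtain ⟨e, hwU, hwD⟩ := hO w hw
    rw [hG]
    refine ⟨hch.mem w hwU, hch''.mem w hwD, fun i => ?_⟩
    rw [hch''.line_eq w hwD, hch.line_eq w hwU, ← e i, ← Submodule.map_comp]
    congr 1
    ext v
    simp
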